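/- Let $(\Sigma,g_\Sigma)$ be a smooth finite-dimensional Riemannian manifold (Hausdorff, second countable, without boundary) that is geodesically complete. For a smooth function $f:\mathbb R\to(0,\infty)$ let $\mathbb R^1_1\times_f\Sigma$ be the GFRW spacetime $\mathbb R\times\Sigma$ with metric $-dt^2+f(t)^2g_\Sigma$, time-oriented by increasing $t$. A metric is called timelike (null, spacelike) geodesically complete if every timelike (null, spacelike) geodesic defined on a nonempty open interval extends to a geodesic defined for all values of the affine parameter in $\mathbb R$, i.e. both to the past and to the future; $\Sigma$ is complete if this holds for all its geodesics. For a future-directed causal geodesic $\gamma$ and $r<s$ put $$H^\gamma=\frac{\dot f(t\circ\gamma)}{f(t\circ\gamma)},\qquad H^\gamma_{avg}[r,s]=\frac1{s-r}\int_r^s H^\gamma(\alpha)\,d\alpha .$$ For $H>0$ and $t_0\in\mathbb R$ let $\mathcal M_{H,t_0}$ (the monster cohort) be the set of smooth $f:\mathbb R\to\mathbb R$ such that $\inf_{\mathbb R}f=a>0$ and $\lim_{t\to-\infty}f(t)=c\ge a$ for some $a,c$, and $f(t)=e^{Ht}$ for all $t>t_0$. Then: 1. For every $H>0$, $t_0\in\mathbb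 R$ and $f\in\mathcal M_{H,t_0}$ the spacetime $\mathbb R^1_1\times_f\Sigma$ is timelike, null and spacelike geodesically complete. Every comoving curve $s\mapsto(s,p)$ is a future-directed causal geodesic on $\mathbb R$. For every future-directed causal geodesic $\gamma:\mathbb R\to\mathbb R\times\Sigma$: - $H^\gamma_{avg}[r,s]=H$ whenever $r<s$ and $t(\gamma(r))\ge t_0$, and such $r$ exist; for every $r$, $H^\gamma_{avg}[r,s]>0$ for all sufficiently large $s$; - $\lim_{s\to\infty}H^\gamma_{avg}[r,s]=H$ for every $r$; $\lim_{r\to-\infty}H^\gamma_{avg}[r,s]=0$ for every $s$; and $\lim_{b\to\infty}H^\gamma_{avg}[-b,qb]=\frac{q}{q+1}H\in(0,H)$ for every $q>0$. 2. For all $H>0$, $t_0\in\mathbb R$ and $\rho\in\mathbb R$ there are $f\in\mathcal M_{H,t_0}$ and $s_1<s_2$ such that $H_{avg}[s_1,s_2]=\rho$ along every comoving geodesic. 3. For all $H>0$, $t_0\in\mathbb R$ the set $\mathcal M_{H,t_0}$ is uncountable, and if $\Sigma$ is nonempty of positive dimension the set of metrics $\{-dt^2+f^2g_\Sigma : f\in\mathcal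 M_{H,t_0}\}$ on $\mathbb R\times\Sigma$ is uncountable. 4. For $H,c>0$ and $f(t)=e^{Ht}+c$ the spacetime $\mathbb R^1_1\times_f\Sigma$ is timelike, null and spacelike geodesically complete. For every future-directed causal geodesic $\gamma:\mathbb R\to\mathbb R\times\Sigma$ and all $r<s$ one has $0<H^\gamma_{avg}[r,s]<H\,\dfrac{e^{Ht(\gamma(s))}}{e^{Ht(\gamma(s))}+c}$, and the three limits in the last item of part 1 hold with this $f$ and $H$. -/

import Mathlib

open Set Filter
open scoped Manifold ContDiff Topology

noncomputable section

section SemiRiemannian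

variable {E : Type*} [NormedAddCommGroup E] [NormedSpace ℝ E]
  {H : Type*} [TopologicalSpace H] (I : ModelWithCorners ℝ E H)
  (M : Type*) [TopologicalSpace M] [ChartedSpace H M]

/-- A field of bilinear forms on the tangent spaces of `M` (a `(0,2)`-tensor field). Metrics of any
signature are treated as such fields. -/
abbrev BilinField : Type _ := ∀ x : M, LinearMap.BilinForm ℝ (TangentSpace I x)

variable {M}

/-- The components of `g` in the chart around `c`: the value of the pull-back of `g` under the
inverse chart at the coordinate point `y` on the coordinate vectors `u`, `v`. -/
def chartMetric (g : BilinField I M) (c : M) (y u v : E) : ℝ :=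
  g ((extChartAt I c).symm y)
    (mfderiv 𝓘(ℝ, E) I (extChartAt I c).symm y u)
    (mfderiv 𝓘(ℝ, E) I (extChartAt I c).symm y v)

/-- The Christoffel symbol of the first kind in the chart around `c`, at the coordinate point `y`:
`Γ(u, v; w) = (∂_u g(v, w) + ∂_v g(u, w) - ∂_w g(u, v)) / 2`. -/
def christoffelFirst (g : BilinField I M) (c : M) (y u v w : E) : ℝ :=
  (fderiv ℝ (fun z => chartMetric I g c z v w) y u
    + fderiv ℝ (fun z => chartMetric I g c z u w) y v
    - fderiv ℝ (fun z => chartMetric I g c z u v) y w) / 2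

/-- `γ` is a geodesic of the metric `g` on the open set `J` of parameters: it is smooth there, and
in every chart its coordinate expression `x` satisfies the geodesic equation
`x'' + Γ(x', x') = 0`, written with lowered index, i.e. tested against all `w` through `g`. -/
def IsGeodesicOn (g : BilinField I M) (γ : ℝ → M) (J : Set ℝ) : Prop :=
  ContMDiffOn 𝓘(ℝ, ℝ) I ∞ γ J ∧
  ∀ c : M, ∀ s ∈ J, γ s ∈ (chartAt H c).source → ∀ w : E,
    let x : ℝ → E := fun r => extChartAt I c (γ r)
    chartMetric I g c (x s) (deriv (deriv x) s) w
      + christoffelFirst I g c (x s) (deriv x s) (deriv x s) w = 0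

/-- The velocity vector of a curve. -/
def velocity (γ : ℝ → M) (s : ℝ) : TangentSpace I (γ s) :=
  mfderiv 𝓘(ℝ, ℝ) I γ s (1 : ℝ)

/-- Timelike vectors, in the signature convention `(-, +, …, +)`. -/
def IsTimelike (g : BilinField I M) (x : M) (v : TangentSpace I x) : Prop := g x v v < 0

/-- Null (lightlike) vectors. -/
def IsNull (g : BilinField I M) (x : M) (v : TangentSpace I x) : Prop := g x v v = 0 ∧ v ≠ 0

/-- Spacelike vectors. -/
def IsSpacelike (g : BilinField I M) (x : M) (v : TangentSpace I x) : Prop := 0 < g x v v ∨ v = 0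

/-- Completeness of all geodesics whose velocity has the property `P`: every such geodesic, given on
a nonempty open interval `J`, is the restriction of a geodesic defined for all values of the affine
parameter, so that it can end neither towards the past nor towards the future. -/
def GeodesicsComplete (g : BilinField I M) (P : ∀ x : M, TangentSpace I x → Prop) : Prop :=
  ∀ (γ : ℝ → M) (J : Set ℝ), IsOpen J → J.OrdConnected → J.Nonempty →
    IsGeodesicOn I g γ J → (∀ s ∈ J, P (γ s) (velocity I γ s)) →
    ∃ γ' : ℝ → M, IsGeodesicOn I g γ' univ ∧ EqOn γ' γ J

/-- Geodesic completeness: no restriction on the velocity. -/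
def GeodesicallyComplete (g : BilinField I M) : Prop :=
  GeodesicsComplete I g fun _ _ => True

end SemiRiemannian

section GFRW

variable {E : Type*} [NormedAddCommGroup E] [NormedSpace ℝ E]
  {S : Type*} [TopologicalSpace S] [ChartedSpace E S]

/-- The field of bilinear forms given by a smooth Riemannian metric on `S`. -/
def riemannianField [IsManifold 𝓘(ℝ, E) ∞ S]
    (g : Bundle.ContMDiffRiemannianMetric 𝓘(ℝ, E) ∞ E (fun x : S => TangentSpace 𝓘(ℝ, E) x)) :
    BilinField 𝓘(ℝ, E) S :=
  fun x => LinearMap.mk₂ ℝ (fun u v => g.inner x u v)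
    (by intros; simp) (by intros; simp) (by intros; simp) (by intros; simp)

/-- The model with corners of the product manifold `ℝ × S`. -/
abbrev gfrwModel (E : Type*) [NormedAddCommGroup E] [NormedSpace ℝ E] :
    ModelWithCorners ℝ (ℝ × E) (ModelProd ℝ E) :=
  (modelWithCornersSelf ℝ ℝ).prod (modelWithCornersSelf ℝ E)

/-- The metric `-dt² + f(t)² g_S` of the generalized Friedmann–Robertson–Walker spacetime
`ℝ¹₁ ×_f S`, where `dt²` and `g_S` are pulled back along the two projections. -/
def gfrwMetric (f : ℝ → ℝ) (gS : BilinField 𝓘(ℝ, E) S) : BilinField (gfrwModel E) (ℝ × S) :=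
  fun p =>
    let dt : TangentSpace (gfrwModel E) p →ₗ[ℝ] ℝ :=
      (mfderiv (gfrwModel E) 𝓘(ℝ, ℝ) (Prod.fst : ℝ × S → ℝ) p).toLinearMap
    let dπ : TangentSpace (gfrwModel E) p →ₗ[ℝ] TangentSpace 𝓘(ℝ, E) p.2 :=
      (mfderiv (gfrwModel E) 𝓘(ℝ, E) (Prod.snd : ℝ × S → S) p).toLinearMap
    (f p.1) ^ 2 • (gS p.2).compl₁₂ dπ dπ - (LinearMap.mul ℝ ℝ).compl₁₂ dt dt

/-- The worldline `s ↦ (s, p)` of a comoving observer. -/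
def comoving (p : S) : ℝ → ℝ × S := fun s => (s, p)

/-- A future-directed causal geodesic of `ℝ¹₁ ×_f S` defined on all of `ℝ`; the time orientation is
the one of increasing `t`. -/
def IsFutureCausalGeodesic (f : ℝ → ℝ) (gS : BilinField 𝓘(ℝ, E) S) (γ : ℝ → ℝ × S) : Prop :=
  IsGeodesicOn (gfrwModel E) (gfrwMetric f gS) γ univ ∧
  ∀ s : ℝ, gfrwMetric f gS (γ s) (velocity (gfrwModel E) γ s) (velocity (gfrwModel E) γ s) ≤ 0 ∧
    0 < deriv (fun r => (γ r).1) s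

/-- The Hubble parameter `H^γ = f'/f` along a curve `γ`, at the parameter `s`. -/
def hubbleAlong (f : ℝ → ℝ) (γ : ℝ → ℝ × S) (s : ℝ) : ℝ :=
  deriv f (γ s).1 / f (γ s).1

/-- The average of `H^γ` over the segment `γ [a, b]`. -/
def hubbleAvg (f : ℝ → ℝ) (γ : ℝ → ℝ × S) (a b : ℝ) : ℝ :=
  (1 / (b - a)) * ∫ s in a..b, hubbleAlong f γ s

/-- The scale functions of the cohort: smooth, with positive infimum `a`, tending to `c ≥ a` in the
distant past, and equal to `exp (H t)` for `t > t₀`. -/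
structure IsMonsterScale (f : ℝ → ℝ) (H t₀ a c : ℝ) : Prop where
  smooth : ContDiff ℝ ∞ f
  hubble_pos : 0 < H
  inf_pos : 0 < a
  isGLB : IsGLB (range f) a
  inf_le : a ≤ c
  tendsto_past : Tendsto f atBot (𝓝 c)
  deSitter : ∀ t, t₀ < t → f t = Real.exp (H * t)

/-- Completeness of the timelike, the null and the spacelike geodesics of `ℝ¹₁ ×_f S`
(each towards the past and the future). -/
def IsCompleteGFRW (f : ℝ → ℝ) (gS : BilinField 𝓘(ℝ, E) S) : Prop :=
  GeodesicsComplete (gfrwModel E) (gfrwMetric f gS) (IsTimelike (gfrwModel E) (gfrwMetric f gS)) ∧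
  GeodesicsComplete (gfrwModel E) (gfrwMetric f gS) (IsNull (gfrwModel E) (gfrwMetric f gS)) ∧
  GeodesicsComplete (gfrwModel E) (gfrwMetric f gS) (IsSpacelike (gfrwModel E) (gfrwMetric f gS))

/-- The asymptotic Hubble averages along `γ`: with the past limit taken last or first, along the
family of segments `[-b, q b]`, and for the past-directed rays. -/
def HasAsymptoticHubbleAverages (f : ℝ → ℝ) (γ : ℝ → ℝ × S) (H : ℝ) : Prop :=
  (∀ a, Tendsto (fun b => hubbleAvg f γ a b) atTop (𝓝 H)) ∧
  (∀ b, Tendsto (fun a => hubbleAvg f γ a b) atBot (𝓝 0)) ∧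
  (∀ q : ℝ, 0 < q →
    Tendsto (fun b => hubbleAvg f γ (-b) (q * b)) atTop (𝓝 (H * (q / (q + 1)))))

end GFRW

end

section ChartForm

variable {E : Type*} [NormedAddCommGroup E] [NormedSpace ℝ E]

/-- The Christoffel symbol of the first kind of a field of bilinear forms on a vector space. -/
noncomputable def coordChristoffel (G : E → E →L[ℝ] E →L[ℝ] ℝ) (y u v w : E) : ℝ :=
  (fderiv ℝ (fun z => G z v w) y u + fderiv ℝ (fun z => G z u w) y v
    - fderiv ℝ (fun z => G z u v) y w) / 2

theorem fderiv_form_apply {G : E → E →L[ℝ] E →L[ℝ] ℝ} {y : E} (hG : DifferentiableAt ℝ G y)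
    (u v w : E) : fderiv ℝ (fun z => G z v w) y u = fderiv ℝ G y u v w := by
  have h := ((hG.hasFDerivAt.clm_apply (hasFDerivAt_const v y)).clm_apply
    (hasFDerivAt_const w y)).fderiv
  rw [h]; simp

theorem coordChristoffel_eq {G : E → E →L[ℝ] E →L[ℝ] ℝ} {y : E} (hG : DifferentiableAt ℝ G y)
    (u v w : E) : coordChristoffel G y u v w =
      (fderiv ℝ G y u v w + fderiv ℝ G y v u w - fderiv ℝ G y w u v) / 2 := by
  simp only [coordChristoffel, fderiv_form_apply hG]

theorem coordChristoffel_smul {G : E → E →L[ℝ] E →L[ℝ] ℝ} {y : E} (hG : DifferentiableAt ℝ G y)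
    (a : ℝ) (u w : E) : coordChristoffel G y (a • u) (a • u) w =
      a ^ 2 * coordChristoffel G y u u w := by
  simp only [coordChristoffel_eq hG, map_smul, smul_apply, smul_eq_mul]
  ring

theorem hasDerivAt_form_velocity {G : E → E →L[ℝ] E →L[ℝ] ℝ} {x v : ℝ → E} {a : E} {s : ℝ}
    (hG : DifferentiableAt ℝ G (x s)) (hsymm : ∀ u w, G (x s) u w = G (x s) w u)
    (hx : HasDerivAt x (v s) s) (hv : HasDerivAt v a s) :
    HasDerivAt (fun r => G (x r) (v r) (v r))
      (2 * (G (x s) a (v s) + coordChristoffel G (x s) (v s) (v s) (v s))) s := by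
  have h0 : HasDerivAt (fun r => G (x r)) (fderiv ℝ G (x s) (v s)) s :=
    HasFDerivAt.comp_hasDerivAt (F := E) (E := E →L[ℝ] E →L[ℝ] ℝ) (l := G) s hG.hasFDerivAt hx
  have h1 : HasDerivAt (fun r => G (x r) (v r))
    (fderiv ℝ G (x s) (v s) (v s) + G (x s) a) s := h0.clm_apply hv
  have h2 : HasDerivAt (fun r => G (x r) (v r) (v r))
    ((fderiv ℝ G (x s) (v s) (v s) + G (x s) a) (v s) + G (x s) (v s) a) s := h1.clm_apply hv
  refine h2.congr_deriv ?_
  rw [coordChristoffel_eq hG]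
  simp only [add_apply, hsymm (v s) a]
  ring

variable {S : Type*} [TopologicalSpace S] [ChartedSpace E S] [IsManifold 𝓘(ℝ, E) ∞ S]
  (gS : Bundle.ContMDiffRiemannianMetric 𝓘(ℝ, E) ∞ E (fun x : S => TangentSpace 𝓘(ℝ, E) x))

/-- The components of a Riemannian metric in a chart, as a continuous bilinear form. -/
noncomputable def chartForm (c : S) (y : E) : E →L[ℝ] E →L[ℝ] ℝ :=
  let A : E →L[ℝ] E := mfderiv 𝓘(ℝ, E) 𝓘(ℝ, E) (extChartAt 𝓘(ℝ, E) c).symm y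
  let B : E →L[ℝ] E →L[ℝ] ℝ := gS.inner ((extChartAt 𝓘(ℝ, E) c).symm y)
  B.bilinearComp A A

theorem chartForm_apply (c : S) (y u v : E) : chartForm gS c y u v =
    gS.inner ((extChartAt 𝓘(ℝ, E) c).symm y)
      (mfderiv 𝓘(ℝ, E) 𝓘(ℝ, E) (extChartAt 𝓘(ℝ, E) c).symm y u)
      (mfderiv 𝓘(ℝ, E) 𝓘(ℝ, E) (extChartAt 𝓘(ℝ, E) c).symm y v) := by
  unfold chartForm
  rfl

theorem chartMetric_riemannianField (c : S) (y u v : E) :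
    chartMetric 𝓘(ℝ, E) (riemannianField gS) c y u v = chartForm gS c y u v := by
  unfold chartMetric riemannianField
  rw [LinearMap.mk₂_apply, chartForm_apply]

theorem christoffelFirst_riemannianField (c : S) (y u v w : E) :
    christoffelFirst 𝓘(ℝ, E) (riemannianField gS) c y u v w =
      coordChristoffel (chartForm gS c) y u v w := by
  unfold christoffelFirst coordChristoffel
  simp only [chartMetric_riemannianField]

theorem chartForm_symm (c : S) (y u v : E) : chartForm gS c y u v = chartForm gS c y v u := by
  rw [chartForm_apply, chartForm_apply, gS.symm]

theorem contMDiffOn_mfderiv_extChartAt_symm (c : S) (u : E) :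
    ContMDiffOn 𝓘(ℝ, E) (𝓘(ℝ, E).prod 𝓘(ℝ, E)) 1
      (fun y => (⟨(extChartAt 𝓘(ℝ, E) c).symm y,
        mfderiv 𝓘(ℝ, E) 𝓘(ℝ, E) (extChartAt 𝓘(ℝ, E) c).symm y u⟩ : TangentBundle 𝓘(ℝ, E) S))
      (extChartAt 𝓘(ℝ, E) c).target := by
  have ho : IsOpen (extChartAt 𝓘(ℝ, E) c).target := isOpen_extChartAt_target c
  have h1 : ContMDiffOn 𝓘(ℝ, E) 𝓘(ℝ, E) ∞ (extChartAt 𝓘(ℝ, E) c).symm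
    (extChartAt 𝓘(ℝ, E) c).target := contMDiffOn_extChartAt_symm c
  have h2 := h1.contMDiffOn_tangentMapWithin (m := 1) (by norm_cast) ho.uniqueMDiffOn
  have h3 : ContMDiff 𝓘(ℝ, E) (𝓘(ℝ, E).prod 𝓘(ℝ, E)) 1
      (fun y : E => (⟨y, u⟩ : TangentBundle 𝓘(ℝ, E) E)) := by
    exact contMDiff_vectorSpace_iff_contDiff.2 contDiff_const
  refine (h2.comp h3.contMDiffOn (s := (extChartAt 𝓘(ℝ, E) c).target) fun y hy => hy).congr ?_
  intro y hy
  simp only [Function.comp_apply, tangentMapWithin]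
  rw [mfderivWithin_of_isOpen ho hy]

theorem differentiableAt_chartForm [FiniteDimensional ℝ E] (c : S) {y : E}
    (hy : y ∈ (extChartAt 𝓘(ℝ, E) c).target) : DifferentiableAt ℝ (chartForm gS c) y := by
  have ho : IsOpen (extChartAt 𝓘(ℝ, E) c).target := isOpen_extChartAt_target c
  suffices h : ContDiffOn ℝ 1 (chartForm gS c) (extChartAt 𝓘(ℝ, E) c).target from
    ((h y hy).contDiffAt (ho.mem_nhds hy)).differentiableAt one_ne_zero
  rw [contDiffOn_clm_apply]
  intro u
  rw [contDiffOn_clm_apply]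
  intro v
  rw [← contMDiffOn_iff_contDiffOn]
  have hb : ContMDiffOn 𝓘(ℝ, E) 𝓘(ℝ, E) 1 (extChartAt 𝓘(ℝ, E) c).symm
    (extChartAt 𝓘(ℝ, E) c).target := contMDiffOn_extChartAt_symm c
  intro z hz
  simp only [chartForm_apply]
  have : ContMDiffWithinAt 𝓘(ℝ, E) (𝓘(ℝ, E).prod 𝓘(ℝ)) 1
      (fun m => Bundle.TotalSpace.mk' ℝ (E := Bundle.Trivial S ℝ)
        ((extChartAt 𝓘(ℝ, E) c).symm m) (gS.inner ((extChartAt 𝓘(ℝ, E) c).symm m)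
          (mfderiv 𝓘(ℝ, E) 𝓘(ℝ, E) (extChartAt 𝓘(ℝ, E) c).symm m u)
          (mfderiv 𝓘(ℝ, E) 𝓘(ℝ, E) (extChartAt 𝓘(ℝ, E) c).symm m v)))
      (extChartAt 𝓘(ℝ, E) c).target z := by
    refine ContMDiffWithinAt.clm_bundle_apply₂ (F₁ := E) (F₂ := E)
      (E₁ := fun x : S => TangentSpace 𝓘(ℝ, E) x) (E₂ := fun x : S => TangentSpace 𝓘(ℝ, E) x)
      (E₃ := Bundle.Trivial S ℝ) (b := (extChartAt 𝓘(ℝ, E) c).symm)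
      (ψ := fun m => gS.inner ((extChartAt 𝓘(ℝ, E) c).symm m))
      (v := fun m => mfderiv 𝓘(ℝ, E) 𝓘(ℝ, E) (extChartAt 𝓘(ℝ, E) c).symm m u)
      (w := fun m => mfderiv 𝓘(ℝ, E) 𝓘(ℝ, E) (extChartAt 𝓘(ℝ, E) c).symm m v) ?_ ?_ ?_
    · exact ContMDiffAt.comp_contMDiffWithinAt z (gS.contMDiff.of_le (by norm_cast)).contMDiffAt
        (hb z hz)
    · exact contMDiffOn_mfderiv_extChartAt_symm c u z hz
    · exact contMDiffOn_mfderiv_extChartAt_symm c v z hz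
  simp only [Bundle.contMDiffWithinAt_totalSpace] at this
  exact this.2

end ChartForm

section Pregeodesic

theorem ContDiffAt.deriv_of_infty {F : Type*} [NormedAddCommGroup F] [NormedSpace ℝ F]
    {x : ℝ → F} {s : ℝ} (h : ContDiffAt ℝ ∞ x s) : ContDiffAt ℝ ∞ (deriv x) s :=
  (h.fderiv_right (m := ∞) (by norm_cast)).clm_apply contDiffAt_const

theorem ContDiffAt.hasDerivAt_of_infty {F : Type*} [NormedAddCommGroup F] [NormedSpace ℝ F]
    {x : ℝ → F} {s : ℝ} (h : ContDiffAt ℝ ∞ x s) : HasDerivAt x (deriv x s) s :=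
  (h.differentiableAt (by simp)).hasDerivAt

theorem ContDiffAt.eventually_hasDerivAt_of_infty {F : Type*} [NormedAddCommGroup F]
    [NormedSpace ℝ F] {x : ℝ → F} {s : ℝ} (h : ContDiffAt ℝ ∞ x s) :
    ∀ᶠ r in 𝓝 s, HasDerivAt x (deriv x r) r := by
  have h1 : ContDiffAt ℝ 1 x s := h.of_le (by norm_cast)
  filter_upwards [h1.eventually (by simp)] with r hr
  exact (hr.differentiableAt (by simp)).hasDerivAt

variable {E : Type*} [NormedAddCommGroup E] [NormedSpace ℝ E]
  {S : Type*} [TopologicalSpace S] [ChartedSpace E S]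
  {σ : ℝ → S} {lam : ℝ → ℝ} {J : Set ℝ} {c : S} {s : ℝ}

theorem eventually_mem_chart_source (hσ : ContMDiffOn 𝓘(ℝ, ℝ) 𝓘(ℝ, E) ∞ σ J) (hJ : IsOpen J)
    (hs : s ∈ J) (hc : σ s ∈ (chartAt E c).source) :
    ∀ᶠ r in 𝓝 s, r ∈ J ∧ σ r ∈ (chartAt E c).source :=
  (hJ.eventually_mem hs).and
    ((hσ.continuousOn.continuousAt (hJ.mem_nhds hs)).eventually
      ((chartAt E c).open_source.mem_nhds hc))

variable [IsManifold 𝓘(ℝ, E) ∞ S]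
  (gS : Bundle.ContMDiffRiemannianMetric 𝓘(ℝ, E) ∞ E (fun x : S => TangentSpace 𝓘(ℝ, E) x))

/-- The squared length of the velocity of a curve. -/
noncomputable def speedSq (σ : ℝ → S) (s : ℝ) : ℝ :=
  gS.inner (σ s) (velocity 𝓘(ℝ, E) σ s) (velocity 𝓘(ℝ, E) σ s)

/-- `σ` is, up to reparametrization, a geodesic: its covariant acceleration is `lam` times its
velocity. -/
def IsPregeodesicOn (σ : ℝ → S) (lam : ℝ → ℝ) (J : Set ℝ) : Prop :=
  ContMDiffOn 𝓘(ℝ, ℝ) 𝓘(ℝ, E) ∞ σ J ∧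
  ∀ c : S, ∀ s ∈ J, σ s ∈ (chartAt E c).source → ∀ w : E,
    let x : ℝ → E := fun r => extChartAt 𝓘(ℝ, E) c (σ r)
    chartForm gS c (x s) (deriv (deriv x) s) w
      + coordChristoffel (chartForm gS c) (x s) (deriv x s) (deriv x s) w
      = lam s * chartForm gS c (x s) (deriv x s) w

variable {gS}

theorem isGeodesicOn_iff_isPregeodesicOn :
    IsGeodesicOn 𝓘(ℝ, E) (riemannianField gS) σ J ↔ IsPregeodesicOn gS σ (fun _ => 0) J := by
  unfold IsGeodesicOn IsPregeodesicOn
  simp only [chartMetric_riemannianField, christoffelFirst_riemannianField, zero_mul]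

theorem IsPregeodesicOn.congr_factor {lam' : ℝ → ℝ} (h : IsPregeodesicOn gS σ lam J)
    (hl : EqOn lam lam' J) : IsPregeodesicOn gS σ lam' J :=
  ⟨h.1, fun c s hs hc w => by rw [← hl hs]; exact h.2 c s hs hc w⟩

theorem contDiffAt_extChartAt_comp (hσ : ContMDiffOn 𝓘(ℝ, ℝ) 𝓘(ℝ, E) ∞ σ J) (hJ : IsOpen J)
    (hs : s ∈ J) (hc : σ s ∈ (chartAt E c).source) :
    ContDiffAt ℝ ∞ (fun r => extChartAt 𝓘(ℝ, E) c (σ r)) s := by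
  rw [← contMDiffAt_iff_contDiffAt]
  exact (contMDiffAt_extChartAt' hc).comp s (hσ.contMDiffAt (hJ.mem_nhds hs))

theorem velocity_eq_mfderiv_symm (hσ : ContMDiffOn 𝓘(ℝ, ℝ) 𝓘(ℝ, E) ∞ σ J) (hJ : IsOpen J)
    (hs : s ∈ J) (hc : σ s ∈ (chartAt E c).source) :
    (velocity 𝓘(ℝ, E) σ s : E) = mfderiv 𝓘(ℝ, E) 𝓘(ℝ, E) (extChartAt 𝓘(ℝ, E) c).symm
      (extChartAt 𝓘(ℝ, E) c (σ s)) (deriv (fun r => extChartAt 𝓘(ℝ, E) c (σ r)) s) := by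
  have hx := contDiffAt_extChartAt_comp hσ hJ hs hc
  have hy : extChartAt 𝓘(ℝ, E) c (σ s) ∈ (extChartAt 𝓘(ℝ, E) c).target :=
    (extChartAt 𝓘(ℝ, E) c).map_source (by rwa [extChartAt_source])
  have hev : σ =ᶠ[𝓝 s] (extChartAt 𝓘(ℝ, E) c).symm ∘ fun r => extChartAt 𝓘(ℝ, E) c (σ r) := by
    filter_upwards [eventually_mem_chart_source hσ hJ hs hc] with r hr
    exact ((extChartAt 𝓘(ℝ, E) c).left_inv (by rw [extChartAt_source]; exact hr.2)).symm
  have hd : MDifferentiableAt 𝓘(ℝ, E) 𝓘(ℝ, E) (extChartAt 𝓘(ℝ, E) c).symm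
      (extChartAt 𝓘(ℝ, E) c (σ s)) :=
    (((contMDiffOn_extChartAt_symm (n := ∞) c) _ hy).contMDiffAt
      ((isOpen_extChartAt_target c).mem_nhds hy)).mdifferentiableAt (by simp)
  have hd' : MDifferentiableAt 𝓘(ℝ, ℝ) 𝓘(ℝ, E) (fun r => extChartAt 𝓘(ℝ, E) c (σ r)) s :=
    (hx.differentiableAt (by simp)).mdifferentiableAt
  unfold velocity
  have h1 := hev.mfderiv_eq (I := 𝓘(ℝ, ℝ)) (I' := 𝓘(ℝ, E))
  have h2 := mfderiv_comp s hd hd'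
  have h3 := congrArg (fun L : ℝ →L[ℝ] E => L 1) (h1.trans h2)
  refine h3.trans ?_
  have h4 : (mfderiv 𝓘(ℝ, ℝ) 𝓘(ℝ, E) (fun r => extChartAt 𝓘(ℝ, E) c (σ r)) s : ℝ →L[ℝ] E) 1
      = deriv (fun r => extChartAt 𝓘(ℝ, E) c (σ r)) s := by
    rw [mfderiv_eq_fderiv]; rfl
  exact congrArg (mfderiv 𝓘(ℝ, E) 𝓘(ℝ, E) (extChartAt 𝓘(ℝ, E) c).symm
    (extChartAt 𝓘(ℝ, E) c (σ s)) : E →L[ℝ] E) h4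

theorem inner_congr_base {p q : S} (h : p = q) (v : E) :
    (gS.inner p : E →L[ℝ] E →L[ℝ] ℝ) v v = (gS.inner q : E →L[ℝ] E →L[ℝ] ℝ) v v := by
  subst h; rfl

theorem speedSq_eq_chartForm (hσ : ContMDiffOn 𝓘(ℝ, ℝ) 𝓘(ℝ, E) ∞ σ J) (hJ : IsOpen J)
    (hs : s ∈ J) (hc : σ s ∈ (chartAt E c).source) :
    speedSq gS σ s = chartForm gS c (extChartAt 𝓘(ℝ, E) c (σ s))
      (deriv (fun r => extChartAt 𝓘(ℝ, E) c (σ r)) s)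
      (deriv (fun r => extChartAt 𝓘(ℝ, E) c (σ r)) s) := by
  rw [chartForm_apply]
  have hv := velocity_eq_mfderiv_symm hσ hJ hs hc
  have hp : (extChartAt 𝓘(ℝ, E) c).symm (extChartAt 𝓘(ℝ, E) c (σ s)) = σ s :=
    (extChartAt 𝓘(ℝ, E) c).left_inv (by rwa [extChartAt_source])
  have h1 : speedSq gS σ s = (gS.inner (σ s) : E →L[ℝ] E →L[ℝ] ℝ)
    (velocity 𝓘(ℝ, E) σ s : E) (velocity 𝓘(ℝ, E) σ s : E) := rfl
  rw [h1, hv]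
  exact (inner_congr_base hp _).symm

theorem speedSq_nonneg (σ : ℝ → S) (s : ℝ) : 0 ≤ speedSq gS σ s := by
  unfold speedSq
  by_cases h : velocity 𝓘(ℝ, E) σ s = 0
  · rw [h]; simp
  · exact (gS.pos _ _ h).le

theorem IsPregeodesicOn.hasDerivAt_speedSq [FiniteDimensional ℝ E]
    (h : IsPregeodesicOn gS σ lam J) (hJ : IsOpen J) (hs : s ∈ J) :
    HasDerivAt (speedSq gS σ) (2 * lam s * speedSq gS σ s) s := by
  have hc : σ s ∈ (chartAt E (σ s)).source := mem_chart_source E (σ s)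
  have hev := eventually_mem_chart_source h.1 hJ hs hc
  have hx := contDiffAt_extChartAt_comp h.1 hJ hs hc
  have hy : extChartAt 𝓘(ℝ, E) (σ s) (σ s) ∈ (extChartAt 𝓘(ℝ, E) (σ s)).target :=
    mem_extChartAt_target (σ s)
  have key := hasDerivAt_form_velocity (x := fun r => extChartAt 𝓘(ℝ, E) (σ s) (σ r))
    (differentiableAt_chartForm gS (σ s) hy) (fun u w => chartForm_symm gS _ _ u w)
    hx.hasDerivAt_of_infty hx.deriv_of_infty.hasDerivAt_of_infty
  have heq : speedSq gS σ =ᶠ[𝓝 s] fun r => chartForm gS (σ s) (extChartAt 𝓘(ℝ, E) (σ s) (σ r))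
      (deriv (fun r => extChartAt 𝓘(ℝ, E) (σ s) (σ r)) r)
      (deriv (fun r => extChartAt 𝓘(ℝ, E) (σ s) (σ r)) r) := by
    filter_upwards [hev] with r hr
    exact speedSq_eq_chartForm h.1 hJ hr.1 hr.2
  refine (key.congr_of_eventuallyEq heq).congr_deriv ?_
  rw [h.2 (σ s) s hs hc, heq.self_of_nhds]
  ring

theorem IsPregeodesicOn.comp [FiniteDimensional ℝ E] {mu : ℝ → ℝ} {U : Set ℝ} {u : ℝ → ℝ}
    (h : IsPregeodesicOn gS σ mu U) (hU : IsOpen U) (hJ : IsOpen J) (hu : ContDiffOn ℝ ∞ u J)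
    (hm : MapsTo u J U) (hu' : ∀ s ∈ J, deriv u s ≠ 0) :
    IsPregeodesicOn gS (σ ∘ u)
      (fun s => deriv u s * mu (u s) + deriv (deriv u) s / deriv u s) J := by
  refine ⟨h.1.comp (contMDiffOn_iff_contDiffOn.2 hu) hm, fun c s hs hc w => ?_⟩
  have hx := contDiffAt_extChartAt_comp h.1 hU (hm hs) hc
  have hus := hu.contDiffAt (hJ.mem_nhds hs)
  set y : ℝ → E := fun r => extChartAt 𝓘(ℝ, E) c (σ r) with hydef
  have hevU := hx.eventually_hasDerivAt_of_infty
  have h1 : deriv (fun r => extChartAt 𝓘(ℝ, E) c ((σ ∘ u) r)) =ᶠ[𝓝 s]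
      fun r => deriv u r • deriv y (u r) := by
    filter_upwards [hus.continuousAt.eventually hevU, hus.eventually_hasDerivAt_of_infty]
      with r hr hr'
    exact (hr.scomp r hr').deriv
  have h2 : HasDerivAt (fun r => deriv u r • deriv y (u r))
      (deriv u s • (deriv u s • deriv (deriv y) (u s)) + deriv (deriv u) s • deriv y (u s)) s := by
    have h3 : HasDerivAt (fun r => deriv y (u r)) (deriv u s • deriv (deriv y) (u s)) s :=
      hx.deriv_of_infty.hasDerivAt_of_infty.scomp s hus.hasDerivAt_of_infty
    exact hus.deriv_of_infty.hasDerivAt_of_infty.smul h3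
  have hy : y (u s) ∈ (extChartAt 𝓘(ℝ, E) c).target :=
    (extChartAt 𝓘(ℝ, E) c).map_source (by rw [extChartAt_source]; exact hc)
  have e2 := (h2.congr_of_eventuallyEq h1).deriv
  have e1 := h1.self_of_nhds
  have hg := h.2 c (u s) (hm hs) hc w
  have hne := hu' s hs
  simp only at hg ⊢
  rw [e2, e1]
  change chartForm gS c (y (u s)) _ w + coordChristoffel _ (y (u s)) _ _ w
    = _ * chartForm gS c (y (u s)) _ w
  rw [coordChristoffel_smul (differentiableAt_chartForm gS c hy)]
  simp only [map_add, map_smul, add_apply, smul_apply, smul_eq_mul]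
  change chartForm gS c (y (u s)) _ w + coordChristoffel _ (y (u s)) _ _ w
    = _ * chartForm gS c (y (u s)) _ w at hg
  field_simp
  linear_combination (deriv u s) ^ 2 * hg

end Pregeodesic

section Warped

variable {E : Type*} [NormedAddCommGroup E] [NormedSpace ℝ E]
  {S : Type*} [TopologicalSpace S] [ChartedSpace E S]

theorem extChartAt_gfrw (c y : ℝ × S) :
    extChartAt (gfrwModel E) c y = (y.1, extChartAt 𝓘(ℝ, E) c.2 y.2) := by
  rw [extChartAt_prod]
  simp [chartAt_self_eq]

theorem extChartAt_gfrw_symm (c : ℝ × S) :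
    ((extChartAt (gfrwModel E) c).symm : ℝ × E → ℝ × S) =
      fun y => (y.1, (extChartAt 𝓘(ℝ, E) c.2).symm y.2) := by
  rw [extChartAt_prod]
  ext y <;> simp [chartAt_self_eq]

theorem velocity_gfrw {γ : ℝ → ℝ × S} {s : ℝ}
    (h1 : DifferentiableAt ℝ (fun r => (γ r).1) s)
    (h2 : MDifferentiableAt 𝓘(ℝ, ℝ) 𝓘(ℝ, E) (fun r => (γ r).2) s) :
    (velocity (gfrwModel E) γ s : ℝ × E) =
      (deriv (fun r => (γ r).1) s, (velocity 𝓘(ℝ, E) (fun r => (γ r).2) s : E)) := by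
  have h := mfderiv_prodMk h1.mdifferentiableAt h2
  rw [mfderiv_eq_fderiv] at h
  exact congrArg (fun L : ℝ →L[ℝ] (ℝ × E) => L 1) h

variable [IsManifold 𝓘(ℝ, E) ∞ S]
  (gS : Bundle.ContMDiffRiemannianMetric 𝓘(ℝ, E) ∞ E (fun x : S => TangentSpace 𝓘(ℝ, E) x))

theorem gfrwMetric_riemannianField_apply (f : ℝ → ℝ) (p : ℝ × S) (U V : ℝ × E) :
    gfrwMetric f (riemannianField gS) p U V =
      f p.1 ^ 2 * (gS.inner p.2 : E →L[ℝ] E →L[ℝ] ℝ) U.2 V.2 - U.1 * V.1 := by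
  unfold gfrwMetric riemannianField
  rw [mfderiv_fst, mfderiv_snd]
  rfl

theorem mfderiv_extChartAt_gfrw_symm (c : ℝ × S) {y : ℝ × E}
    (hy : y.2 ∈ (extChartAt 𝓘(ℝ, E) c.2).target) (u : ℝ × E) :
    (mfderiv 𝓘(ℝ, ℝ × E) (gfrwModel E) (extChartAt (gfrwModel E) c).symm y u : ℝ × E) =
      (u.1, (mfderiv 𝓘(ℝ, E) 𝓘(ℝ, E) (extChartAt 𝓘(ℝ, E) c.2).symm y.2 u.2 : E)) := by
  rw [extChartAt_gfrw_symm]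
  have h1 : MDifferentiableAt 𝓘(ℝ, ℝ × E) 𝓘(ℝ, ℝ) (Prod.fst : ℝ × E → ℝ) y :=
    differentiableAt_fst.mdifferentiableAt
  have h2 : MDifferentiableAt 𝓘(ℝ, ℝ × E) 𝓘(ℝ, E) (Prod.snd : ℝ × E → E) y :=
    differentiableAt_snd.mdifferentiableAt
  have h3 : MDifferentiableAt 𝓘(ℝ, E) 𝓘(ℝ, E) (extChartAt 𝓘(ℝ, E) c.2).symm y.2 :=
    (((contMDiffOn_extChartAt_symm (n := ∞) c.2) _ hy).contMDiffAt
      ((isOpen_extChartAt_target c.2).mem_nhds hy)).mdifferentiableAt (by simp)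
  have h4 := mfderiv_prodMk h1 (h3.comp y h2)
  have h5 := mfderiv_comp y h3 h2
  rw [h5, mfderiv_eq_fderiv, mfderiv_eq_fderiv, fderiv_fst, fderiv_snd] at h4
  exact congrArg (fun L : (ℝ × E) →L[ℝ] (ℝ × E) => L u) h4

theorem chartMetric_gfrw (f : ℝ → ℝ) (c : ℝ × S) {y : ℝ × E}
    (hy : y.2 ∈ (extChartAt 𝓘(ℝ, E) c.2).target) (u v : ℝ × E) :
    chartMetric (gfrwModel E) (gfrwMetric f (riemannianField gS)) c y u v =
      f y.1 ^ 2 * chartForm gS c.2 y.2 u.2 v.2 - u.1 * v.1 := by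
  unfold chartMetric
  have h := gfrwMetric_riemannianField_apply gS f ((extChartAt (gfrwModel E) c).symm y)
    (mfderiv 𝓘(ℝ, ℝ × E) (gfrwModel E) (extChartAt (gfrwModel E) c).symm y u)
    (mfderiv 𝓘(ℝ, ℝ × E) (gfrwModel E) (extChartAt (gfrwModel E) c).symm y v)
  refine h.trans ?_
  rw [mfderiv_extChartAt_gfrw_symm c hy, mfderiv_extChartAt_gfrw_symm c hy, extChartAt_gfrw_symm,
    chartForm_apply]

theorem eventually_chartMetric_gfrw (f : ℝ → ℝ) (c : ℝ × S) {y : ℝ × E}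
    (hy : y.2 ∈ (extChartAt 𝓘(ℝ, E) c.2).target) (u v : ℝ × E) :
    (fun z => chartMetric (gfrwModel E) (gfrwMetric f (riemannianField gS)) c z u v) =ᶠ[𝓝 y]
      fun z => f z.1 ^ 2 * chartForm gS c.2 z.2 u.2 v.2 - u.1 * v.1 := by
  filter_upwards [continuousAt_snd.eventually ((isOpen_extChartAt_target c.2).eventually_mem hy)]
    with z hz
  exact chartMetric_gfrw gS f c hz u v

theorem fderiv_chartMetric_gfrw [FiniteDimensional ℝ E] {f : ℝ → ℝ} (c : ℝ × S) {y : ℝ × E}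
    (hf : DifferentiableAt ℝ f y.1) (hy : y.2 ∈ (extChartAt 𝓘(ℝ, E) c.2).target)
    (u v w : ℝ × E) :
    fderiv ℝ (fun z => chartMetric (gfrwModel E) (gfrwMetric f (riemannianField gS)) c z v w) y u =
      2 * f y.1 * deriv f y.1 * u.1 * chartForm gS c.2 y.2 v.2 w.2 +
        f y.1 ^ 2 * fderiv ℝ (chartForm gS c.2) y.2 u.2 v.2 w.2 := by
  rw [(eventually_chartMetric_gfrw gS f c hy v w).fderiv_eq]
  have h1 : HasFDerivAt (fun z : ℝ × E => f z.1)
      (deriv f y.1 • ContinuousLinearMap.fst ℝ ℝ E) y :=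
    hf.hasDerivAt.comp_hasFDerivAt y hasFDerivAt_fst
  have h2 : HasFDerivAt (fun z : E => chartForm gS c.2 z v.2 w.2)
      (fderiv ℝ (fun z : E => chartForm gS c.2 z v.2 w.2) y.2) y.2 :=
    (((differentiableAt_chartForm gS c.2 hy).clm_apply
      (differentiableAt_const v.2)).clm_apply (differentiableAt_const w.2)).hasFDerivAt
  have h3 : HasFDerivAt (fun z : ℝ × E => chartForm gS c.2 z.2 v.2 w.2)
      ((fderiv ℝ (fun z : E => chartForm gS c.2 z v.2 w.2) y.2).comp
        (ContinuousLinearMap.snd ℝ ℝ E)) y :=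
    HasFDerivAt.comp (g := fun z : E => chartForm gS c.2 z v.2 w.2) y h2 hasFDerivAt_snd
  have h4 : HasFDerivAt
      (fun z : ℝ × E => f z.1 ^ 2 * chartForm gS c.2 z.2 v.2 w.2 - v.1 * w.1) _ y :=
    ((h1.pow 2).mul h3).sub_const (v.1 * w.1)
  rw [h4.fderiv, ← fderiv_form_apply (differentiableAt_chartForm gS c.2 hy)]
  simp
  ring

theorem christoffelFirst_gfrw [FiniteDimensional ℝ E] {f : ℝ → ℝ} (c : ℝ × S) {y : ℝ × E}
    (hf : DifferentiableAt ℝ f y.1) (hy : y.2 ∈ (extChartAt 𝓘(ℝ, E) c.2).target)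
    (u w : ℝ × E) :
    christoffelFirst (gfrwModel E) (gfrwMetric f (riemannianField gS)) c y u u w =
      2 * f y.1 * deriv f y.1 * u.1 * chartForm gS c.2 y.2 u.2 w.2
        - f y.1 * deriv f y.1 * w.1 * chartForm gS c.2 y.2 u.2 u.2
        + f y.1 ^ 2 * coordChristoffel (chartForm gS c.2) y.2 u.2 u.2 w.2 := by
  unfold christoffelFirst
  rw [fderiv_chartMetric_gfrw gS c hf hy, fderiv_chartMetric_gfrw gS c hf hy,
    coordChristoffel_eq (differentiableAt_chartForm gS c.2 hy)]
  ring

variable {gS} {f : ℝ → ℝ} {γ : ℝ → ℝ × S} {J : Set ℝ}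

theorem gfrw_equation_iff [FiniteDimensional ℝ E] (hf : ContDiff ℝ ∞ f) (hpos : ∀ t, 0 < f t)
    (hJ : IsOpen J) (h1 : ContDiffOn ℝ ∞ (fun s => (γ s).1) J)
    (h2 : ContMDiffOn 𝓘(ℝ, ℝ) 𝓘(ℝ, E) ∞ (fun s => (γ s).2) J) {c : ℝ × S} {s : ℝ} (hs : s ∈ J)
    (hc : (γ s).2 ∈ (chartAt E c.2).source) :
    (∀ w : ℝ × E, let x : ℝ → ℝ × E := fun r => extChartAt (gfrwModel E) c (γ r)
      chartMetric (gfrwModel E) (gfrwMetric f (riemannianField gS)) c (x s) (deriv (deriv x) s) w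
        + christoffelFirst (gfrwModel E) (gfrwMetric f (riemannianField gS)) c
          (x s) (deriv x s) (deriv x s) w = 0) ↔
    (∀ w : E, let x : ℝ → E := fun r => extChartAt 𝓘(ℝ, E) c.2 (γ r).2
      chartForm gS c.2 (x s) (deriv (deriv x) s) w
        + coordChristoffel (chartForm gS c.2) (x s) (deriv x s) (deriv x s) w
        = -2 * deriv f (γ s).1 * deriv (fun r => (γ r).1) s / f (γ s).1
          * chartForm gS c.2 (x s) (deriv x s) w) ∧
    deriv (deriv fun r => (γ r).1) s =
      -(f (γ s).1 * deriv f (γ s).1 * speedSq gS (fun r => (γ r).2) s) := by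
  have ht := h1.contDiffAt (hJ.mem_nhds hs)
  have hx := contDiffAt_extChartAt_comp h2 hJ hs hc
  have hy : extChartAt 𝓘(ℝ, E) c.2 (γ s).2 ∈ (extChartAt 𝓘(ℝ, E) c.2).target :=
    (extChartAt 𝓘(ℝ, E) c.2).map_source (by rwa [extChartAt_source])
  have hfd : DifferentiableAt ℝ f (γ s).1 := hf.differentiable (by simp) _
  rw [speedSq_eq_chartForm h2 hJ hs hc]
  simp only [extChartAt_gfrw]
  have e1 : deriv (fun r => ((γ r).1, extChartAt 𝓘(ℝ, E) c.2 (γ r).2)) =ᶠ[𝓝 s] fun r =>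
      (deriv (fun r => (γ r).1) r, deriv (fun r => extChartAt 𝓘(ℝ, E) c.2 (γ r).2) r) := by
    filter_upwards [ht.eventually_hasDerivAt_of_infty, hx.eventually_hasDerivAt_of_infty]
      with r hr hr'
    exact (hr.prodMk hr').deriv
  have e2 := ((ht.deriv_of_infty.hasDerivAt_of_infty.prodMk
    hx.deriv_of_infty.hasDerivAt_of_infty).congr_of_eventuallyEq e1).deriv
  have e3 := e1.self_of_nhds
  beta_reduce at e3
  rw [e2, e3]
  generalize deriv (fun r => extChartAt 𝓘(ℝ, E) c.2 (γ r).2) s = x' at *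
  generalize deriv (deriv fun r => extChartAt 𝓘(ℝ, E) c.2 (γ r).2) s = x'' at *
  generalize extChartAt 𝓘(ℝ, E) c.2 (γ s).2 = x at *
  have key : ∀ w : ℝ × E, chartMetric (gfrwModel E) (gfrwMetric f (riemannianField gS)) c
      ((γ s).1, x) (deriv (deriv fun r => (γ r).1) s, x'') w +
      christoffelFirst (gfrwModel E) (gfrwMetric f (riemannianField gS)) c ((γ s).1, x)
        (deriv (fun r => (γ r).1) s, x') (deriv (fun r => (γ r).1) s, x') w =
      f (γ s).1 ^ 2 * chartForm gS c.2 x x'' w.2 - deriv (deriv fun r => (γ r).1) s * w.1 +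
      (2 * f (γ s).1 * deriv f (γ s).1 * deriv (fun r => (γ r).1) s * chartForm gS c.2 x x' w.2
        - f (γ s).1 * deriv f (γ s).1 * w.1 * chartForm gS c.2 x x' x'
        + f (γ s).1 ^ 2 * coordChristoffel (chartForm gS c.2) x x' x' w.2) := by
    intro w
    rw [chartMetric_gfrw gS f c hy,
      christoffelFirst_gfrw gS (y := ((γ s).1, x)) c hfd hy]
  simp only [key]
  have hne := (hpos (γ s).1).ne'
  constructor
  · intro h
    refine ⟨fun w => ?_, ?_⟩
    · have := h (0, w)
      simp only [mul_zero, zero_mul, sub_zero] at this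
      field_simp
      refine mul_left_cancel₀ hne ?_
      linear_combination this
    · have := h (1, 0)
      simp only [map_zero, coordChristoffel_eq (differentiableAt_chartForm gS c.2 hy)] at this
      simp only [zero_apply] at this
      linear_combination -this
  · rintro ⟨h, h'⟩ w
    have h3 := h w.2
    field_simp at h3
    rw [h']
    linear_combination f (γ s).1 * h3

theorem isGeodesicOn_gfrw_iff [FiniteDimensional ℝ E] (hf : ContDiff ℝ ∞ f)
    (hpos : ∀ t, 0 < f t) (hJ : IsOpen J) :
    IsGeodesicOn (gfrwModel E) (gfrwMetric f (riemannianField gS)) γ J ↔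
      ContDiffOn ℝ ∞ (fun s => (γ s).1) J ∧
      IsPregeodesicOn gS (fun s => (γ s).2)
        (fun s => -2 * deriv f (γ s).1 * deriv (fun r => (γ r).1) s / f (γ s).1) J ∧
      ∀ s ∈ J, deriv (deriv fun r => (γ r).1) s =
        -(f (γ s).1 * deriv f (γ s).1 * speedSq gS (fun r => (γ r).2) s) := by
  unfold IsGeodesicOn
  rw [contMDiffOn_prod_iff]
  constructor
  · rintro ⟨⟨h1, h2⟩, h⟩
    have h1' : ContDiffOn ℝ ∞ (fun s => (γ s).1) J := contMDiffOn_iff_contDiffOn.1 h1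
    refine ⟨h1', ⟨h2, fun c s hs hc => ?_⟩, fun s hs => ?_⟩
    · exact ((gfrw_equation_iff hf hpos hJ h1' h2 (c := ((γ s).1, c)) hs hc).1
        (h ((γ s).1, c) s hs (by simpa [chartAt_self_eq] using hc))).1
    · exact ((gfrw_equation_iff hf hpos hJ h1' h2 (c := γ s) hs (mem_chart_source E _)).1
        (h (γ s) s hs (mem_chart_source _ _))).2
  · rintro ⟨h1, h2, h3⟩
    refine ⟨⟨contMDiffOn_iff_contDiffOn.2 h1, h2.1⟩, fun c s hs hc => ?_⟩
    have hc' : (γ s).2 ∈ (chartAt E c.2).source := by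
      simpa [chartAt_self_eq] using hc
    exact (gfrw_equation_iff hf hpos hJ h1 h2.1 hs hc').2 ⟨h2.2 c.2 s hs hc', h3 s hs⟩

end Warped

section Newton

/-- The nearest point to `y` in the interval `[-R, R]`. -/
noncomputable def clamp (R y : ℝ) : ℝ := max (-R) (min R y)

theorem abs_clamp_le {R : ℝ} (hR : 0 ≤ R) (y : ℝ) : |clamp R y| ≤ R := by
  unfold clamp
  exact abs_le.2 ⟨le_max_left _ _, max_le (by linarith) (min_le_left _ _)⟩

theorem clamp_eq_self {R y : ℝ} (h : |y| ≤ R) : clamp R y = y := by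
  have := abs_le.1 h
  unfold clamp
  rw [min_eq_right this.2, max_eq_right this.1]

theorem clamp_neg (R y : ℝ) (hR : 0 ≤ R) : clamp R (-y) = -clamp R y := by
  unfold clamp
  rcases le_total R y with h | h <;> rcases le_total R (-y) with h' | h' <;>
    rcases le_total (-R) y with h2 | h2 <;> rcases le_total (-R) (-y) with h3 | h3 <;>
    simp only [max_def, min_def] <;> split_ifs <;> linarith

theorem lipschitzWith_clamp (R : ℝ) : LipschitzWith 1 (clamp R) :=
  (LipschitzWith.id.const_min R).const_max (-R)

/-- The primitive of `clamp R`, the kinetic energy for velocities truncated at `R`. -/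
noncomputable def kinetic (R p : ℝ) : ℝ := ∫ y in (0 : ℝ)..p, clamp R y

theorem hasDerivAt_kinetic (R p : ℝ) : HasDerivAt (kinetic R) (clamp R p) p :=
  ((lipschitzWith_clamp R).continuous.integral_hasStrictDerivAt 0 p).hasDerivAt

theorem kinetic_of_abs_le {R p : ℝ} (h : |p| ≤ R) : kinetic R p = p ^ 2 / 2 := by
  unfold kinetic
  have h1 : ∫ y in (0 : ℝ)..p, clamp R y = ∫ y in (0 : ℝ)..p, y := by
    refine intervalIntegral.integral_congr fun y hy => clamp_eq_self ?_
    have := abs_sub_left_of_mem_uIcc hy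
    simp only [sub_zero] at this
    exact this.trans h
  rw [h1, integral_id]; ring

theorem kinetic_neg {R : ℝ} (hR : 0 ≤ R) (p : ℝ) : kinetic R (-p) = kinetic R p := by
  unfold kinetic
  have h := intervalIntegral.integral_comp_neg (a := 0) (b := p) (clamp R)
  simp only [clamp_neg R _ hR, intervalIntegral.integral_neg, neg_zero] at h
  rw [intervalIntegral.integral_symm, ← h, neg_neg]

theorem le_kinetic {R p : ℝ} (hR : 0 ≤ R) (h : R ≤ |p|) : R ^ 2 / 2 ≤ kinetic R p := by
  wlog hp : 0 ≤ p generalizing p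
  · rw [← kinetic_neg hR]
    exact this (by rwa [abs_neg]) (by linarith)
  rw [abs_of_nonneg hp] at h
  rw [← kinetic_of_abs_le (abs_of_nonneg hR).le]
  have hm : MonotoneOn (kinetic R) (Ici 0) := by
    refine monotoneOn_of_deriv_nonneg (convex_Ici 0)
      (fun x _ => (hasDerivAt_kinetic R x).continuousAt.continuousWithinAt)
      (fun x _ => (hasDerivAt_kinetic R x).differentiableAt.differentiableWithinAt) fun x hx => ?_
    rw [(hasDerivAt_kinetic R x).deriv]
    rw [interior_Ici] at hx
    exact le_max_of_le_right (le_min hR (le_of_lt hx))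
  exact hm hR hp h

theorem exists_newton_solution_Ioo {W : ℝ → ℝ} (hW : ContDiff ℝ ∞ W) {B : ℝ} (hB : ∀ x, W x ≤ B)
    (x₀ v₀ : ℝ) {N : ℝ} (hN : 0 < N) :
    ∃ γ : ℝ → ℝ × ℝ, γ 0 = (x₀, v₀) ∧
      ∀ s ∈ Ioo (-N) N, HasDerivAt γ ((γ s).2, deriv W (γ s).1) s := by
  have hdW : ContDiff ℝ ∞ (deriv W) := (contDiff_infty_iff_deriv.1 hW).2
  obtain ⟨C, hC0, hC1, hC2⟩ : ∃ C : ℝ, 0 < C ∧ |v₀| ≤ C ∧ v₀ ^ 2 / 2 - W x₀ + B < C ^ 2 / 2 := by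
    refine ⟨|v₀| + |v₀ ^ 2 / 2 - W x₀ + B| + 2, by positivity, ?_, ?_⟩
    · linarith [abs_nonneg (v₀ ^ 2 / 2 - W x₀ + B)]
    · nlinarith [abs_nonneg (v₀ ^ 2 / 2 - W x₀ + B), abs_nonneg v₀,
        le_abs_self (v₀ ^ 2 / 2 - W x₀ + B)]
  set A : ℝ := |x₀| + C * N with hA
  have hA0 : 0 ≤ A := by positivity
  obtain ⟨K, hK⟩ : ∃ K, LipschitzOnWith K (deriv W) (Icc (-A) A) :=
    hdW.contDiffOn.exists_lipschitzOnWith (by simp) (convex_Icc _ _) isCompact_Icc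
  obtain ⟨M, hM⟩ := isCompact_Icc.exists_bound_of_continuousOn
    (hdW.continuous.continuousOn (s := Icc (-A) A))
  have hclamp : ∀ x, clamp A x ∈ Icc (-A) A := fun x => abs_le.1 (abs_clamp_le hA0 x)
  set v : ℝ × ℝ → ℝ × ℝ := fun p => (clamp C p.2, deriv W (clamp A p.1)) with hv
  have hlip : LipschitzWith (max 1 K) v := by
    have h1 : LipschitzWith 1 fun p : ℝ × ℝ => clamp C p.2 := by
      have := (lipschitzWith_clamp C).comp (LipschitzWith.prod_snd (α := ℝ) (β := ℝ))
      rwa [mul_one] at this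
    have h2 : LipschitzWith K fun p : ℝ × ℝ => deriv W (clamp A p.1) := by
      have h3 : LipschitzWith 1 fun p : ℝ × ℝ => clamp A p.1 := by
        have := (lipschitzWith_clamp A).comp (LipschitzWith.prod_fst (α := ℝ) (β := ℝ))
        rwa [mul_one] at this
      have := hK.comp h3.lipschitzOnWith (s := univ) fun p _ => hclamp p.1
      rw [lipschitzOnWith_univ, mul_one] at this
      exact this
    exact h1.prodMk h2
  set L : NNReal := (max C M).toNNReal with hLdef
  have hL : (L : ℝ) = max C M := Real.coe_toNNReal _ (le_max_of_le_left hC0.le)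
  have hbound : ∀ p, ‖v p‖ ≤ L := by
    intro p
    rw [hL, Prod.norm_def]
    exact max_le_max (abs_clamp_le hC0.le _) (hM _ (hclamp _))
  have h0 : (0 : ℝ) ∈ Icc (-N) N := ⟨by linarith, hN.le⟩
  have hPL : IsPicardLindelof (fun _ => v) (⟨0, h0⟩ : Icc (-N) N) (x₀, v₀) (L * N.toNNReal) 0 L
      (max 1 K) := by
    refine IsPicardLindelof.of_time_independent (fun p _ => hbound p) hlip.lipschitzOnWith ?_
    simp [hN.le]
  obtain ⟨γ, hγ0, hγ⟩ := hPL.exists_eq_forall_mem_Icc_hasDerivWithinAt₀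
  simp only at hγ0
  have hx : ∀ s ∈ Icc (-N) N, HasDerivWithinAt (fun r => (γ r).1) (clamp C (γ s).2)
      (Icc (-N) N) s := fun s hs => (hasFDerivWithinAt_fst (p := γ s)
        (s := univ)).comp_hasDerivWithinAt s (hγ s hs) fun _ _ => mem_univ _
  have hp : ∀ s ∈ Icc (-N) N, HasDerivWithinAt (fun r => (γ r).2) (deriv W (clamp A (γ s).1))
      (Icc (-N) N) s := fun s hs => (hasFDerivWithinAt_snd (p := γ s)
        (s := univ)).comp_hasDerivWithinAt s (hγ s hs) fun _ _ => mem_univ _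
  have hxA : ∀ s ∈ Icc (-N) N, |(γ s).1| ≤ A := by
    intro s hs
    have h1 := (convex_Icc (-N) N).norm_image_sub_le_of_norm_hasDerivWithin_le hx
      (fun r _ => abs_clamp_le hC0.le _) h0 hs
    rw [hγ0] at h1
    simp only [Real.norm_eq_abs, sub_zero] at h1
    have h2 : |s| ≤ N := abs_le.2 hs
    have h3 := abs_sub_abs_le_abs_sub (γ s).1 x₀
    nlinarith
  have hE : ∀ s ∈ Icc (-N) N, kinetic C (γ s).2 - W (γ s).1 = v₀ ^ 2 / 2 - W x₀ := by
    intro s hs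
    have hder : ∀ r ∈ Icc (-N) N,
        HasDerivWithinAt (fun r => kinetic C (γ r).2 - W (γ r).1) 0 (Icc (-N) N) r := by
      intro r hr
      have h1 := (hasDerivAt_kinetic C (γ r).2).comp_hasDerivWithinAt r (hp r hr)
      have h2 := ((hW.differentiable (by simp)) (γ r).1).hasDerivAt.comp_hasDerivWithinAt r
        (hx r hr)
      refine (h1.sub h2).congr_deriv ?_
      rw [clamp_eq_self (hxA r hr)]
      ring
    have h1 := (convex_Icc (-N) N).norm_image_sub_le_of_norm_hasDerivWithin_le hder (C := 0)
      (fun r _ => by simp) h0 hs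
    rw [zero_mul, norm_le_zero_iff, sub_eq_zero, hγ0] at h1
    rw [h1, kinetic_of_abs_le hC1]
  have hpC : ∀ s ∈ Icc (-N) N, |(γ s).2| ≤ C := by
    intro s hs
    by_contra! h
    linarith [le_kinetic hC0.le h.le, hE s hs, hB (γ s).1]
  refine ⟨γ, hγ0, fun s hs => ?_⟩
  have hs' := Ioo_subset_Icc_self hs
  have := (hγ s hs').hasDerivAt (Icc_mem_nhds hs.1 hs.2)
  simp only [hv] at this
  rwa [clamp_eq_self (hpC s hs'), clamp_eq_self (hxA s hs')] at this

theorem isMIntegralCurveOn_iff_hasDerivAt {F : Type*} [NormedAddCommGroup F] [NormedSpace ℝ F]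
    {γ : ℝ → F} {v : F → F} {J : Set ℝ} (hJ : IsOpen J) :
    IsMIntegralCurveOn (I := 𝓘(ℝ, F)) γ v J ↔ ∀ s ∈ J, HasDerivAt γ (v (γ s)) s := by
  refine forall₂_congr fun s hs => ?_
  refine hasMFDerivWithinAt_iff_hasFDerivWithinAt.trans ?_
  exact ⟨fun h => HasDerivWithinAt.hasDerivAt h (hJ.mem_nhds hs),
    fun h => HasDerivAt.hasDerivWithinAt h⟩

theorem contMDiff_newton_section {W : ℝ → ℝ} (hW : ContDiff ℝ ∞ W) :
    ContMDiff 𝓘(ℝ, ℝ × ℝ) 𝓘(ℝ, ℝ × ℝ).tangent 1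
      (fun p : ℝ × ℝ => (⟨p, (p.2, deriv W p.1)⟩ : TangentBundle 𝓘(ℝ, ℝ × ℝ) (ℝ × ℝ))) :=
  contMDiff_vectorSpace_iff_contDiff.2 (contDiff_snd.prodMk
    (((contDiff_infty_iff_deriv.1 hW).2.of_le (by norm_cast)).comp contDiff_fst))

theorem exists_newton_solution {W : ℝ → ℝ} (hW : ContDiff ℝ ∞ W) {B : ℝ} (hB : ∀ x, W x ≤ B)
    (s₀ x₀ v₀ : ℝ) :
    ∃ T : ℝ → ℝ, ContDiff ℝ ∞ T ∧ T s₀ = x₀ ∧ deriv T s₀ = v₀ ∧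
      ∀ s, deriv (deriv T) s = deriv W (T s) := by
  obtain ⟨γ, hγ0, hγ⟩ := (exists_isMIntegralCurve_iff_exists_isMIntegralCurveOn_Ioo
    (I := 𝓘(ℝ, ℝ × ℝ)) (v := fun p : ℝ × ℝ => (p.2, deriv W p.1)) (contMDiff_newton_section hW)
    (x₀, v₀)).2 fun a => by
      rcases le_or_gt a 0 with ha | ha
      · refine ⟨fun _ => (x₀, v₀), rfl, fun s hs => ?_⟩
        exact absurd (hs.1.trans hs.2) (by linarith)
      · obtain ⟨γ, h0, h1⟩ := exists_newton_solution_Ioo hW hB x₀ v₀ ha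
        exact ⟨γ, h0, (isMIntegralCurveOn_iff_hasDerivAt isOpen_Ioo).2 h1⟩
  have hd : ∀ s, HasDerivAt γ ((γ s).2, deriv W (γ s).1) s := fun s =>
    (isMIntegralCurveOn_iff_hasDerivAt isOpen_univ).1
      (isMIntegralCurve_iff_isMIntegralCurveOn.1 hγ) s (mem_univ s)
  have hv : ContDiff ℝ ∞ (fun p : ℝ × ℝ => (p.2, deriv W p.1)) :=
    contDiff_snd.prodMk ((contDiff_infty_iff_deriv.1 hW).2.comp contDiff_fst)
  have hderiv : deriv γ = (fun p : ℝ × ℝ => (p.2, deriv W p.1)) ∘ γ := funext fun s => (hd s).deriv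
  have hγs : ContDiff ℝ ∞ γ := by
    refine contDiff_infty.2 fun n => ?_
    induction n with
    | zero => exact contDiff_zero.2 (continuous_iff_continuousAt.2 fun s => (hd s).continuousAt)
    | succ n ih =>
      rw [Nat.cast_succ]
      refine contDiff_succ_iff_deriv.2
        ⟨fun s => (hd s).differentiableAt, fun h => absurd h (by simp), ?_⟩
      rw [hderiv]
      exact (hv.of_le (by exact_mod_cast le_top)).comp ih
  have h1 : ∀ s, HasDerivAt (fun r => (γ r).1) (γ s).2 s := fun s =>
    (hasFDerivAt_fst (p := γ s)).comp_hasDerivAt s (hd s)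
  have h2 : ∀ s, HasDerivAt (fun r => (γ r).2) (deriv W (γ s).1) s := fun s =>
    (hasFDerivAt_snd (p := γ s)).comp_hasDerivAt s (hd s)
  have h3 : deriv (fun r => (γ r).1) = fun r => (γ r).2 := funext fun s => (h1 s).deriv
  have h4 : ∀ s, HasDerivAt (fun r => (γ (r - s₀)).1) (γ (s - s₀)).2 s := fun s =>
    (h1 (s - s₀)).comp_sub_const s s₀
  have h5 : ∀ s, HasDerivAt (fun r => (γ (r - s₀)).2) (deriv W (γ (s - s₀)).1) s := fun s =>
    (h2 (s - s₀)).comp_sub_const s s₀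
  have h6 : deriv (fun r => (γ (r - s₀)).1) = fun r => (γ (r - s₀)).2 :=
    funext fun s => (h4 s).deriv
  refine ⟨fun r => (γ (r - s₀)).1,
    contDiff_fst.comp (hγs.comp (contDiff_id.sub contDiff_const)), by simp [hγ0], ?_, fun s => ?_⟩
  · rw [h6]; simp [hγ0]
  · rw [h6]; exact (h5 s).deriv

theorem newton_solution_unique {W : ℝ → ℝ} (hW : ContDiff ℝ ∞ W) {J : Set ℝ} (hJ : IsOpen J)
    (hJc : J.OrdConnected) {T₁ T₂ : ℝ → ℝ} (h₁ : ContDiffOn ℝ ∞ T₁ J) (h₂ : ContDiffOn ℝ ∞ T₂ J)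
    (e₁ : ∀ s ∈ J, deriv (deriv T₁) s = deriv W (T₁ s))
    (e₂ : ∀ s ∈ J, deriv (deriv T₂) s = deriv W (T₂ s)) {s₀ : ℝ} (hs₀ : s₀ ∈ J)
    (h0 : T₁ s₀ = T₂ s₀) (h0' : deriv T₁ s₀ = deriv T₂ s₀) : EqOn T₁ T₂ J := by
  have aux : ∀ T : ℝ → ℝ, ContDiffOn ℝ ∞ T J → (∀ s ∈ J, deriv (deriv T) s = deriv W (T s)) →
      ∀ s ∈ J, HasDerivAt (fun r => (T r, deriv T r)) (deriv T s, deriv W (T s)) s := by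
    intro T hT he s hs
    have h := hT.contDiffAt (hJ.mem_nhds hs)
    rw [← he s hs]
    exact h.hasDerivAt_of_infty.prodMk h.deriv_of_infty.hasDerivAt_of_infty
  intro s hs
  obtain ⟨a, b, hs₀', hs', hab⟩ : ∃ a b : ℝ, s₀ ∈ Ioo a b ∧ s ∈ Ioo a b ∧ Ioo a b ⊆ J := by
    have hm : min s₀ s ∈ J := by rcases min_choice s₀ s with h | h <;> rwa [h]
    have hM : max s₀ s ∈ J := by rcases max_choice s₀ s with h | h <;> rwa [h]
    obtain ⟨a, ha, haJ⟩ := exists_Ioc_subset_of_mem_nhds (hJ.mem_nhds hm) (exists_lt _)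
    obtain ⟨b, hb, hbJ⟩ := exists_Ico_subset_of_mem_nhds (hJ.mem_nhds hM) (exists_gt _)
    refine ⟨a, b, ⟨ha.trans_le (min_le_left _ _), (le_max_left _ _).trans_lt hb⟩,
      ⟨ha.trans_le (min_le_right _ _), (le_max_right _ _).trans_lt hb⟩, fun r hr => ?_⟩
    rcases le_total r (min s₀ s) with h | h
    · exact haJ ⟨hr.1, h⟩
    rcases le_total r (max s₀ s) with h' | h'
    · exact hJc.out hm hM ⟨h, h'⟩
    · exact hbJ ⟨h', hr.2⟩
  have := isMIntegralCurveOn_Ioo_eqOn_of_contMDiff_boundaryless (I := 𝓘(ℝ, ℝ × ℝ))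
    (v := fun p : ℝ × ℝ => (p.2, deriv W p.1)) hs₀' (contMDiff_newton_section hW)
    ((isMIntegralCurveOn_iff_hasDerivAt isOpen_Ioo).2
      fun r hr => aux T₁ h₁ e₁ r (hab hr))
    ((isMIntegralCurveOn_iff_hasDerivAt isOpen_Ioo).2
      fun r hr => aux T₂ h₂ e₂ r (hab hr)) (by simp [h0, h0'])
  exact congrArg Prod.fst (this hs')

end Newton

section Completeness

theorem exists_smooth_inverse_primitive {φ : ℝ → ℝ} (hφ : ContDiff ℝ ∞ φ) (hpos : ∀ s, 0 < φ s) :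
    ∃ u v : ℝ → ℝ, ContDiff ℝ ∞ u ∧ (∀ s, HasDerivAt u (φ s) s) ∧ (∀ s, v (u s) = s) ∧
      IsOpenMap u ∧ ∀ s, ContDiffAt ℝ ∞ v (u s) ∧ HasDerivAt v (φ s)⁻¹ (u s) := by
  set u : ℝ → ℝ := fun s => ∫ r in (0 : ℝ)..s, φ r with hu
  have hus : ∀ s, HasStrictDerivAt u (φ s) s := fun s =>
    hφ.continuous.integral_hasStrictDerivAt 0 s
  have hud : ∀ s, HasDerivAt u (φ s) s := fun s => (hus s).hasDerivAt
  have huc : ContDiff ℝ ∞ u := by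
    refine contDiff_infty_iff_deriv.2 ⟨fun s => (hud s).differentiableAt, ?_⟩
    rwa [show deriv u = φ from funext fun s => (hud s).deriv]
  have hmono : StrictMono u := strictMono_of_deriv_pos fun s => by
    rw [(hud s).deriv]; exact hpos s
  have hopen : IsOpenMap u := isOpenMap_of_hasStrictDerivAt hus fun s => (hpos s).ne'
  have hemb : Topology.IsOpenEmbedding u :=
    .of_continuous_injective_isOpenMap huc.continuous hmono.injective hopen
  set e := hemb.toOpenPartialHomeomorph u with he
  have heu : ∀ s, e s = u s := fun s => rfl
  have hleft : ∀ s, e.symm (u s) = s := fun s => e.left_inv (mem_univ s)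
  have htar : ∀ s, u s ∈ e.target := fun s => e.map_source (mem_univ s)
  refine ⟨u, e.symm, huc, hud, hleft, hopen, fun s => ⟨?_, ?_⟩⟩
  · refine e.contDiffAt_symm_deriv (hpos s).ne' (htar s) ?_ ?_
    · rw [hleft]; exact hud s
    · exact huc.contDiffAt
  · refine e.hasDerivAt_symm (htar s) (hpos s).ne' ?_
    rw [hleft]; exact hud s

variable {E : Type*} [NormedAddCommGroup E] [NormedSpace ℝ E]
  {S : Type*} [TopologicalSpace S] [ChartedSpace E S] [IsManifold 𝓘(ℝ, E) ∞ S]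
  {gS : Bundle.ContMDiffRiemannianMetric 𝓘(ℝ, E) ∞ E (fun x : S => TangentSpace 𝓘(ℝ, E) x)}

theorem speedSq_congr {σ σ' : ℝ → S} {s : ℝ} (h : σ =ᶠ[𝓝 s] σ') :
    speedSq gS σ s = speedSq gS σ' s := by
  have h1 : (velocity 𝓘(ℝ, E) σ s : E) = velocity 𝓘(ℝ, E) σ' s :=
    congrArg (fun L : ℝ →L[ℝ] E => L 1) h.mfderiv_eq
  have h2 : speedSq gS σ s = (gS.inner (σ s) : E →L[ℝ] E →L[ℝ] ℝ)
    (velocity 𝓘(ℝ, E) σ s : E) (velocity 𝓘(ℝ, E) σ s : E) := rfl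
  rw [h2, h1]
  exact inner_congr_base h.self_of_nhds _

variable [FiniteDimensional ℝ E]

theorem IsPregeodesicOn.pow_four_mul_speedSq_eq {f t : ℝ → ℝ} {σ : ℝ → S} {J : Set ℝ}
    (hf : ContDiff ℝ ∞ f) (hpos : ∀ x, 0 < f x) (hJ : IsOpen J) (hJc : J.OrdConnected)
    (ht : ContDiffOn ℝ ∞ t J)
    (h : IsPregeodesicOn gS σ (fun s => -2 * deriv f (t s) * deriv t s / f (t s)) J)
    {s s' : ℝ} (hs : s ∈ J) (hs' : s' ∈ J) :
    f (t s) ^ 4 * speedSq gS σ s = f (t s') ^ 4 * speedSq gS σ s' := by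
  have hder : ∀ r ∈ J, HasDerivAt (fun r => f (t r) ^ 4 * speedSq gS σ r) 0 r := by
    intro r hr
    have h1 : HasDerivAt (fun r => f (t r)) (deriv f (t r) * deriv t r) r :=
      (hf.differentiable (by simp) (t r)).hasDerivAt.comp r
        (ht.contDiffAt (hJ.mem_nhds hr)).hasDerivAt_of_infty
    refine ((h1.pow 4).mul (h.hasDerivAt_speedSq hJ hr)).congr_deriv ?_
    have := (hpos (t r)).ne'
    simp only [Pi.pow_apply]
    field_simp
    ring
  exact hJ.is_const_of_deriv_eq_zero hJc.isPreconnected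
    (fun r hr => (hder r hr).differentiableAt.differentiableWithinAt)
    (fun r hr => (hder r hr).deriv) hs hs'

theorem hasDerivAt_centrifugal {f : ℝ → ℝ} (hf : ContDiff ℝ ∞ f) (hpos : ∀ x, 0 < f x) (k x : ℝ) :
    HasDerivAt (fun x => k / (2 * f x ^ 2)) (-(k * deriv f x / f x ^ 3)) x := by
  have h1 := (hf.differentiable (by simp) x).hasDerivAt
  have hne := (hpos x).ne'
  refine ((hasDerivAt_const x k).div ((h1.pow 2).const_mul 2) (by simp [hne])).congr_deriv ?_
  simp only [Pi.pow_apply]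
  field_simp
  ring

theorem geodesicallyComplete_gfrw {f : ℝ → ℝ} (hf : ContDiff ℝ ∞ f) {a : ℝ} (ha : 0 < a)
    (hfa : ∀ x, a ≤ f x) (hS : GeodesicallyComplete 𝓘(ℝ, E) (riemannianField gS)) :
    GeodesicallyComplete (gfrwModel E) (gfrwMetric f (riemannianField gS)) := by
  intro γ J hJ hJc ⟨s₀, hs₀⟩ hγ _
  have hpos : ∀ x, 0 < f x := fun x => ha.trans_le (hfa x)
  have hfd : ∀ x, HasDerivAt f (deriv f x) x := fun x => (hf.differentiable (by simp) x).hasDerivAt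
  obtain ⟨ht, hσ, htt⟩ := (isGeodesicOn_gfrw_iff hf hpos hJ).1 hγ
  set t : ℝ → ℝ := fun s => (γ s).1 with htdef
  set σ : ℝ → S := fun s => (γ s).2 with hσdef
  set k : ℝ := f (t s₀) ^ 4 * speedSq gS σ s₀ with hk
  have hkJ : ∀ s ∈ J, f (t s) ^ 4 * speedSq gS σ s = k := fun s hs =>
    hσ.pow_four_mul_speedSq_eq hf hpos hJ hJc ht hs hs₀
  have hk0 : 0 ≤ k := mul_nonneg (by positivity) (speedSq_nonneg _ _)
  set W : ℝ → ℝ := fun x => k / (2 * f x ^ 2) with hWdef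
  have hWd : ∀ x, deriv W x = -(k * deriv f x / f x ^ 3) := fun x =>
    (hasDerivAt_centrifugal hf hpos k x).deriv
  have hW : ContDiff ℝ ∞ W := contDiff_const.div (contDiff_const.mul (hf.pow 2)) fun x => by
    have := hpos x; positivity
  have hWB : ∀ x, W x ≤ k / (2 * a ^ 2) := fun x => by
    have := hfa x
    simp only [hWdef]
    gcongr
  obtain ⟨T, hTs, hT0, hT0', hTT⟩ := exists_newton_solution hW hWB s₀ (t s₀) (deriv t s₀)
  have hTt : EqOn T t J := by
    refine newton_solution_unique hW hJ hJc hTs.contDiffOn ht (fun s _ => hTT s) (fun s hs => ?_)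
      hs₀ hT0 hT0'
    have h1 := htt s hs
    have h2 := hkJ s hs
    have hne := (hpos (t s)).ne'
    rw [hWd, ← h2]
    refine h1.trans ?_
    field_simp
    ring
  have hTd : ∀ s, HasDerivAt T (deriv T s) s := fun s => hTs.contDiffAt.hasDerivAt_of_infty
  have hfT : ∀ s, HasDerivAt (fun s => f (T s)) (deriv f (T s) * deriv T s) s := fun s =>
    (hfd (T s)).comp s (hTd s)
  have hfTs : ContDiff ℝ ∞ fun s => f (T s) := hf.comp hTs
  obtain ⟨u, v, hu, hud, hvu, huo, hv⟩ := exists_smooth_inverse_primitive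
    (φ := fun s => (f (T s) ^ 2)⁻¹) ((hfTs.pow 2).inv fun s => (pow_pos (hpos _) 2).ne')
    fun s => inv_pos.2 (pow_pos (hpos _) 2)
  have hU : IsOpen (u '' J) := huo J hJ
  have hUc : (u '' J).OrdConnected :=
    (hJc.isPreconnected.image u hu.continuous.continuousOn).ordConnected
  have hvJ : MapsTo v (u '' J) J := by
    rintro _ ⟨s, hs, rfl⟩
    rwa [hvu]
  have hvs : ContDiffOn ℝ ∞ v (u '' J) := by
    rintro _ ⟨s, _, rfl⟩
    exact (hv s).1.contDiffWithinAt
  have hdv : ∀ s, deriv v (u s) = f (T s) ^ 2 := fun s => by rw [(hv s).2.deriv, inv_inv]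
  have hβ0 := hσ.comp hJ hU hvs hvJ (by
    rintro _ ⟨s, _, rfl⟩
    rw [hdv]
    exact (pow_pos (hpos _) 2).ne')
  have hβ : IsGeodesicOn 𝓘(ℝ, E) (riemannianField gS) (σ ∘ v) (u '' J) := by
    refine isGeodesicOn_iff_isPregeodesicOn.2 (hβ0.congr_factor ?_)
    rintro _ ⟨s, hs, rfl⟩
    have h1 : deriv v =ᶠ[𝓝 (u s)] fun r => f (T (v r)) ^ 2 := by
      filter_upwards [hU.mem_nhds ⟨s, hs, rfl⟩]
      rintro _ ⟨s', _, rfl⟩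
      rw [hdv, hvu]
    have h2 : HasDerivAt (fun s => f (T s)) (deriv f (T s) * deriv T s) (v (u s)) := by
      rw [hvu]; exact hfT s
    have h3 : HasDerivAt (fun r => f (T (v r)))
        (deriv f (T s) * deriv T s * (f (T s) ^ 2)⁻¹⁻¹) (u s) := h2.comp (u s) (hv s).2
    have h4 := ((h3.pow 2).congr_of_eventuallyEq h1).deriv
    have hTt' : deriv T s = deriv t s := (hTt.eventuallyEq_of_mem (hJ.mem_nhds hs)).deriv_eq
    simp only
    have hγT : (γ s).1 = T s := (hTt hs).symm
    rw [h4, hdv, hvu, hγT, ← hTt', inv_inv]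
    have hne := (hpos (T s)).ne'
    push_cast
    field_simp
    ring
  obtain ⟨β', hβ', hββ'⟩ := hS (σ ∘ v) (u '' J) hU hUc ⟨u s₀, s₀, hs₀, rfl⟩ hβ fun _ _ => trivial
  have hσ' : IsPregeodesicOn gS (β' ∘ u)
      (fun s => -2 * deriv f (T s) * deriv T s / f (T s)) univ := by
    have h0 : ∀ s, deriv u s = (f (T s) ^ 2)⁻¹ := fun s => (hud s).deriv
    have h1 := (isGeodesicOn_iff_isPregeodesicOn.1 hβ').comp isOpen_univ isOpen_univ
      hu.contDiffOn (mapsTo_univ _ _) fun s _ => by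
        rw [h0]; exact (inv_pos.2 (pow_pos (hpos _) 2)).ne'
    refine h1.congr_factor fun s _ => ?_
    have hne := (hpos (T s)).ne'
    have h2 : deriv (deriv u) s =
        -(2 * f (T s) * (deriv f (T s) * deriv T s)) / (f (T s) ^ 2) ^ 2 := by
      rw [funext h0]
      refine (((hfT s).pow 2).inv (pow_ne_zero 2 hne)).deriv.trans ?_
      simp
    simp only
    rw [h2, h0]
    field_simp
    ring
  have heqJ : EqOn (β' ∘ u) σ J := fun s hs => by
    rw [Function.comp_apply, hββ' ⟨s, hs, rfl⟩, Function.comp_apply, hvu]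
  refine ⟨fun s => (T s, (β' ∘ u) s), (isGeodesicOn_gfrw_iff hf hpos isOpen_univ).2
    ⟨hTs.contDiffOn, hσ', fun s _ => ?_⟩, fun s hs => Prod.ext (hTt hs) (heqJ hs)⟩
  have h1 := hσ'.pow_four_mul_speedSq_eq hf hpos isOpen_univ ordConnected_univ hTs.contDiffOn
    (mem_univ s) (mem_univ s₀)
  rw [speedSq_congr (heqJ.eventuallyEq_of_mem (hJ.mem_nhds hs₀)), hT0, ← hk] at h1
  have hne := (hpos (T s)).ne'
  change deriv (deriv T) s = -(f (T s) * deriv f (T s) * speedSq gS (β' ∘ u) s)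
  rw [hTT, hWd, ← h1]
  field_simp

theorem isCompleteGFRW {f : ℝ → ℝ} (hf : ContDiff ℝ ∞ f) {a : ℝ} (ha : 0 < a)
    (hfa : ∀ x, a ≤ f x) (hS : GeodesicallyComplete 𝓘(ℝ, E) (riemannianField gS)) :
    IsCompleteGFRW f (riemannianField gS) := by
  have h := geodesicallyComplete_gfrw hf ha hfa hS
  refine ⟨?_, ?_, ?_⟩ <;> exact fun γ J h1 h2 h3 h4 _ => h γ J h1 h2 h3 h4 fun _ _ => trivial

end Completeness

section Averages

theorem tendsto_atTop_of_hasDerivAt_comp {t g : ℝ → ℝ} (hg : Continuous g) (hpos : ∀ x, 0 < g x)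
    (ht : ∀ s, HasDerivAt t (g (t s)) s) : Tendsto t atTop atTop := by
  have hmono : StrictMono t := strictMono_of_deriv_pos fun s => by
    rw [(ht s).deriv]; exact hpos _
  refine tendsto_atTop_atTop_of_monotone hmono.monotone fun b => ?_
  by_contra! h
  obtain ⟨x, _, hx⟩ := isCompact_Icc.exists_isMinOn ⟨t 0, left_mem_Icc.2 (h 0).le⟩
    (hg.continuousOn (s := Icc (t 0) b))
  have hle := (convex_Ici (0 : ℝ)).mul_sub_le_image_sub_of_le_deriv (f := t) (C := g x)
    (fun s _ => (ht s).continuousAt.continuousWithinAt)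
    (fun s _ => (ht s).differentiableAt.differentiableWithinAt) (fun s hs => by
      rw [interior_Ici] at hs
      rw [(ht s).deriv]
      exact hx ⟨hmono.monotone (le_of_lt hs), (h s).le⟩)
  have hs0 : 0 ≤ (b - t 0) / g x := div_nonneg (by linarith [h 0]) (hpos x).le
  have h1 := hle 0 self_mem_Ici ((b - t 0) / g x) hs0 hs0
  rw [sub_zero, mul_div_cancel₀ _ (hpos x).ne'] at h1
  linarith [h ((b - t 0) / g x)]

theorem tendsto_atBot_of_hasDerivAt_comp {t g : ℝ → ℝ} (hg : Continuous g) (hpos : ∀ x, 0 < g x)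
    (ht : ∀ s, HasDerivAt t (g (t s)) s) : Tendsto t atBot atBot := by
  have h := tendsto_atTop_of_hasDerivAt_comp (t := fun s => -t (-s)) (g := fun x => g (-x))
    (hg.comp continuous_neg) (fun x => hpos _) fun s =>
      ((ht (-s)).scomp s (hasDerivAt_neg s)).neg.congr_deriv (by simp)
  have h2 := tendsto_neg_atTop_atBot.comp (h.comp tendsto_neg_atBot_atTop)
  refine h2.congr fun s => by simp

theorem tendsto_integral_div_atTop {h : ℝ → ℝ} (hc : Continuous h) {H : ℝ}
    (hlim : Tendsto h atTop (𝓝 H)) :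
    Tendsto (fun b => (∫ s in (0 : ℝ)..b, h s) / b) atTop (𝓝 H) := by
  rw [Metric.tendsto_atTop]
  intro ε hε
  obtain ⟨M, hM⟩ := Metric.tendsto_atTop.1 hlim (ε / 2) (by positivity)
  set A : ℝ := |(∫ s in (0 : ℝ)..M, h s) - H * M| with hA
  refine ⟨max (|M| + 1) (2 * (A + ε * |M|) / ε + 1), fun b hb => ?_⟩
  have hb1 : |M| + 1 ≤ b := (le_max_left _ _).trans hb
  have hb2 : 2 * (A + ε * |M|) / ε + 1 ≤ b := (le_max_right _ _).trans hb
  have hb0 : 0 < b := by linarith [abs_nonneg M]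
  have hMb : M ≤ b := by linarith [le_abs_self M]
  have h1 : ‖∫ s in M..b, (h s - H)‖ ≤ ε / 2 * |b - M| :=
    intervalIntegral.norm_integral_le_of_norm_le_const fun s hs => by
      rw [uIoc_of_le hMb] at hs
      exact (hM s hs.1.le).le
  have hint : ∀ a b, IntervalIntegrable h MeasureTheory.volume a b := fun a b =>
    hc.intervalIntegrable a b
  have h2 : ∫ s in M..b, (h s - H) = (∫ s in (0 : ℝ)..b, h s) - H * b
      - ((∫ s in (0 : ℝ)..M, h s) - H * M) := by
    rw [intervalIntegral.integral_sub (hint _ _) (by simp), intervalIntegral.integral_const,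
      ← intervalIntegral.integral_interval_sub_left (hint 0 b) (hint 0 M), smul_eq_mul]
    ring
  rw [h2, Real.norm_eq_abs, abs_of_nonneg (by linarith : 0 ≤ b - M)] at h1
  have h3 : |(∫ s in (0 : ℝ)..b, h s) - H * b| ≤ ε / 2 * (b - M) + A := by
    have := abs_sub_abs_le_abs_sub ((∫ s in (0 : ℝ)..b, h s) - H * b)
      ((∫ s in (0 : ℝ)..M, h s) - H * M)
    linarith
  rw [Real.dist_eq, div_sub' hb0.ne', abs_div, abs_of_pos hb0, div_lt_iff₀ hb0, mul_comm b H]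
  have h4 : A + ε * |M| < ε * b / 2 := by
    have : 2 * (A + ε * |M|) / ε < b := by linarith
    rw [div_lt_iff₀ hε] at this
    linarith
  nlinarith [neg_abs_le M, abs_nonneg M]

theorem tendsto_average {h : ℝ → ℝ} (hc : Continuous h) {H l : ℝ} (hlim : Tendsto h atTop (𝓝 H))
    (hpast : Tendsto (fun r => ∫ s in r..(0 : ℝ), h s) atBot (𝓝 l)) :
    (∀ a, Tendsto (fun b => (1 / (b - a)) * ∫ s in a..b, h s) atTop (𝓝 H)) ∧
    (∀ b, Tendsto (fun a => (1 / (b - a)) * ∫ s in a..b, h s) atBot (𝓝 0)) ∧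
    (∀ q : ℝ, 0 < q → Tendsto (fun b => (1 / (q * b - -b)) * ∫ s in (-b)..(q * b), h s) atTop
      (𝓝 (H * (q / (q + 1))))) := by
  have hint : ∀ a b, IntervalIntegrable h MeasureTheory.volume a b := fun a b =>
    hc.intervalIntegrable a b
  have hces := tendsto_integral_div_atTop hc hlim
  have hsplit : ∀ a b, ∫ s in a..b, h s = (∫ s in a..(0 : ℝ), h s) + ∫ s in (0 : ℝ)..b, h s :=
    fun a b => (intervalIntegral.integral_add_adjacent_intervals (hint _ _) (hint _ _)).symm
  refine ⟨fun a => ?_, fun b => ?_, fun q hq => ?_⟩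
  · have h1 : Tendsto (fun b : ℝ => b - a) atTop atTop := tendsto_atTop_add_const_right _ _ tendsto_id
    have h2 : Tendsto (fun b : ℝ => 1 + a * (b - a)⁻¹) atTop (𝓝 (1 + a * 0)) :=
      (h1.inv_tendsto_atTop.const_mul a).const_add 1
    have h3 : Tendsto (fun b : ℝ => (b - a)⁻¹ * ∫ s in a..(0 : ℝ), h s) atTop
        (𝓝 (0 * ∫ s in a..(0 : ℝ), h s)) := h1.inv_tendsto_atTop.mul_const _
    have h4 := h3.add (h2.mul hces)
    simp only [zero_mul, mul_zero, add_zero, one_mul, zero_add] at h4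
    refine h4.congr' ?_
    filter_upwards [eventually_gt_atTop 0, eventually_gt_atTop a] with b hb hba
    have : b - a ≠ 0 := (sub_pos.2 hba).ne'
    rw [hsplit a b]
    field_simp
    ring
  · have h1 : Tendsto (fun a : ℝ => b - a) atBot atTop :=
      tendsto_atTop_add_const_left _ _ tendsto_neg_atBot_atTop
    have h2 := h1.inv_tendsto_atTop.mul (hpast.add_const (∫ s in (0 : ℝ)..b, h s))
    rw [zero_mul] at h2
    refine h2.congr fun a => ?_
    rw [hsplit a b, one_div]
    rfl
  · have h1 : Tendsto (fun b : ℝ => q * b) atTop atTop := tendsto_id.const_mul_atTop hq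
    have h2 := (hces.comp h1).const_mul (q / (q + 1))
    have h3 := (hpast.comp tendsto_neg_atTop_atBot).mul
      (tendsto_inv_atTop_zero (𝕜 := ℝ)) |>.const_mul (1 / (q + 1))
    have h4 := h2.add h3
    rw [mul_zero, mul_zero, add_zero, mul_comm _ H] at h4
    refine h4.congr' ?_
    filter_upwards [eventually_gt_atTop 0] with b hb
    have h5 : q * b - -b = (q + 1) * b := by ring
    simp only [Function.comp_apply]
    rw [h5, hsplit (-b) (q * b)]
    have : q + 1 ≠ 0 := by positivity
    field_simp
    ring

theorem tendsto_integral_hubbleAlong_atBot {S : Type*} {f : ℝ → ℝ} (hf : ContDiff ℝ ∞ f) {a c : ℝ}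
    (ha : 0 < a) (hfa : ∀ x, a ≤ f x) (hlim : Tendsto f atBot (𝓝 c)) {w : ℝ → ℝ}
    (hw : ContinuousOn w (Ioi 0)) (hw0 : ∀ y, 0 < y → 0 < w y) {γ : ℝ → ℝ × S}
    (hγ : ∀ s, HasDerivAt (fun r => (γ r).1) (w (f (γ s).1)) s)
    (hbot : Tendsto (fun r => (γ r).1) atBot atBot) :
    ∃ l, Tendsto (fun r => ∫ s in r..(0 : ℝ), hubbleAlong f γ s) atBot (𝓝 l) := by
  have hmax : ∀ y, 0 < max y a := fun y => lt_max_of_lt_right ha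
  have hcm : Continuous fun y : ℝ => max y a := continuous_id.max continuous_const
  have hcont : Continuous fun y => (max y a * w (max y a))⁻¹ :=
    (hcm.mul (hw.comp_continuous hcm hmax)).inv₀ fun y =>
      (mul_pos (hmax y) (hw0 _ (hmax y))).ne'
  set Ψ : ℝ → ℝ := fun y => ∫ z in (0 : ℝ)..y, (max z a * w (max z a))⁻¹ with hΨ
  have hΨd : ∀ y, HasDerivAt Ψ (max y a * w (max y a))⁻¹ y := fun y =>
    (hcont.integral_hasStrictDerivAt 0 y).hasDerivAt
  have htc : Continuous fun r => (γ r).1 := continuous_iff_continuousAt.2 fun s =>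
    (hγ s).continuousAt
  have hder : ∀ s, HasDerivAt (fun r => Ψ (f (γ r).1)) (hubbleAlong f γ s) s := by
    intro s
    have h1 := (hΨd (f (γ s).1)).comp s
      ((hf.differentiable (by simp) (γ s).1).hasDerivAt.comp s (hγ s))
    refine h1.congr_deriv ?_
    have h2 : 0 < f (γ s).1 := ha.trans_le (hfa _)
    have h3 := (hw0 _ h2).ne'
    rw [max_eq_left (hfa _), hubbleAlong]
    field_simp
  have hhc : Continuous (hubbleAlong f γ) :=
    ((hf.continuous_deriv (by simp)).comp htc).div (hf.continuous.comp htc)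
      fun s => (ha.trans_le (hfa _)).ne'
  refine ⟨Ψ (f (γ 0).1) - Ψ c, ?_⟩
  have h1 : Tendsto (fun r => Ψ (f (γ r).1)) atBot (𝓝 (Ψ c)) :=
    (hΨd c).continuousAt.tendsto.comp (hlim.comp hbot)
  refine (h1.const_sub (Ψ (f (γ 0).1))).congr fun r => ?_
  rw [intervalIntegral.integral_eq_sub_of_hasDerivAt (fun s _ => hder s)
    (hhc.intervalIntegrable _ _)]

variable {E : Type*} [NormedAddCommGroup E] [NormedSpace ℝ E]
  {S : Type*} [TopologicalSpace S] [ChartedSpace E S] [IsManifold 𝓘(ℝ, E) ∞ S]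
  {gS : Bundle.ContMDiffRiemannianMetric 𝓘(ℝ, E) ∞ E (fun x : S => TangentSpace 𝓘(ℝ, E) x)}

theorem gfrwMetric_velocity {f : ℝ → ℝ} {γ : ℝ → ℝ × S} {s : ℝ}
    (h1 : DifferentiableAt ℝ (fun r => (γ r).1) s)
    (h2 : MDifferentiableAt 𝓘(ℝ, ℝ) 𝓘(ℝ, E) (fun r => (γ r).2) s) :
    gfrwMetric f (riemannianField gS) (γ s) (velocity (gfrwModel E) γ s)
      (velocity (gfrwModel E) γ s) =
      f (γ s).1 ^ 2 * speedSq gS (fun r => (γ r).2) s - deriv (fun r => (γ r).1) s ^ 2 := by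
  refine (gfrwMetric_riemannianField_apply gS f (γ s) _ _).trans ?_
  rw [velocity_gfrw h1 h2, sq (deriv _ _)]
  rfl

variable [FiniteDimensional ℝ E]

/-- Along a future-directed causal geodesic `t' = w (f t)`, with `w` a positive function. -/
theorem IsFutureCausalGeodesic.exists_hasDerivAt_time {f : ℝ → ℝ} (hf : ContDiff ℝ ∞ f)
    (hpos : ∀ x, 0 < f x) {γ : ℝ → ℝ × S} (hγ : IsFutureCausalGeodesic f (riemannianField gS) γ) :
    ∃ w : ℝ → ℝ, ContinuousOn w (Ioi 0) ∧ (∀ y, 0 < y → 0 < w y) ∧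
      ∀ s, HasDerivAt (fun r => (γ r).1) (w (f (γ s).1)) s := by
  obtain ⟨ht, hσ, htt⟩ := (isGeodesicOn_gfrw_iff hf hpos isOpen_univ).1 hγ.1
  set t : ℝ → ℝ := fun s => (γ s).1 with htdef
  set σ : ℝ → S := fun s => (γ s).2 with hσdef
  set k : ℝ := f (t 0) ^ 4 * speedSq gS σ 0 with hk
  have hk0 : 0 ≤ k := mul_nonneg (by positivity) (speedSq_nonneg _ _)
  have hks : ∀ s, f (t s) ^ 4 * speedSq gS σ s = k := fun s =>
    hσ.pow_four_mul_speedSq_eq hf hpos isOpen_univ ordConnected_univ ht (mem_univ s) (mem_univ 0)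
  have hts : ∀ s, ContDiffAt ℝ ∞ t s := fun s => ht.contDiffAt univ_mem
  have hE : ∀ s, HasDerivAt (fun s => deriv t s ^ 2 / 2 - k / (2 * f (t s) ^ 2)) 0 s := by
    intro s
    have h1 := ((hts s).deriv_of_infty.hasDerivAt_of_infty.pow 2).div_const 2
    have h2 := (hasDerivAt_centrifugal hf hpos k (t s)).comp s (hts s).hasDerivAt_of_infty
    refine (h1.sub h2).congr_deriv ?_
    have h3 : deriv (deriv t) s = -(f (t s) * deriv f (t s) * speedSq gS σ s) :=
      htt s (mem_univ s)
    have hne := (hpos (t s)).ne'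
    rw [h3, ← hks s]
    push_cast
    field_simp
    ring
  set m : ℝ := deriv t 0 ^ 2 - k / f (t 0) ^ 2 with hm
  have hms : ∀ s, deriv t s ^ 2 = m + k / f (t s) ^ 2 := by
    intro s
    have h1 := is_const_of_deriv_eq_zero (fun r => (hE r).differentiableAt)
      (fun r => (hE r).deriv) s 0
    have hne := (hpos (t s)).ne'
    have hne0 := (hpos (t 0)).ne'
    rw [hm]
    field_simp at h1 ⊢
    linarith
  have hm0 : 0 ≤ m := by
    have h1 := (hγ.2 0).1
    rw [gfrwMetric_velocity ((hts 0).differentiableAt (by simp))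
      ((hσ.1.contMDiffAt univ_mem).mdifferentiableAt (by simp))] at h1
    have h2 : f (t 0) ^ 2 * speedSq gS σ 0 = k / f (t 0) ^ 2 := by
      have hne0 := (hpos (t 0)).ne'
      rw [hk]
      field_simp
    have h3 : f (t 0) ^ 2 * speedSq gS σ 0 - deriv t 0 ^ 2 ≤ 0 := h1
    linarith [hms 0]
  have hmk : ∀ y : ℝ, 0 < y → 0 < m + k / y ^ 2 := by
    intro y hy
    rcases hm0.lt_or_eq with h | h
    · positivity
    · have h1 : 0 < deriv t 0 := (hγ.2 0).2
      have h2 := hms 0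
      rw [← h, zero_add] at h2 ⊢
      have h3 : k ≠ 0 := by
        rintro h4
        rw [h4, zero_div] at h2
        exact h1.ne' (pow_eq_zero_iff two_ne_zero |>.1 h2)
      have : 0 < k := hk0.lt_of_ne' h3
      positivity
  refine ⟨fun y => Real.sqrt (m + k / y ^ 2), ?_, fun y hy => Real.sqrt_pos.2 (hmk y hy),
    fun s => ?_⟩
  · refine (continuousOn_const.add (continuousOn_const.div (continuousOn_pow 2) fun y hy => ?_)).sqrt
    exact pow_ne_zero 2 (ne_of_gt hy)
  · have h1 : deriv t s = Real.sqrt (m + k / f (t s) ^ 2) := by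
      rw [← hms s, Real.sqrt_sq (le_of_lt (hγ.2 s).2)]
    change HasDerivAt t (Real.sqrt (m + k / f (t s) ^ 2)) s
    rw [← h1]
    exact (hts s).hasDerivAt_of_infty

/-- The facts about future-directed causal geodesics behind the Hubble averages. -/
theorem IsFutureCausalGeodesic.time_and_averages {f : ℝ → ℝ} (hf : ContDiff ℝ ∞ f) {a c H : ℝ}
    (ha : 0 < a) (hfa : ∀ x, a ≤ f x) (hbot : Tendsto f atBot (𝓝 c))
    (htop : Tendsto (fun x => deriv f x / f x) atTop (𝓝 H)) {γ : ℝ → ℝ × S}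
    (hγ : IsFutureCausalGeodesic f (riemannianField gS) γ) :
    StrictMono (fun s => (γ s).1) ∧ Tendsto (fun s => (γ s).1) atTop atTop ∧
      Continuous (hubbleAlong f γ) ∧ HasAsymptoticHubbleAverages f γ H := by
  have hpos : ∀ x, 0 < f x := fun x => ha.trans_le (hfa x)
  obtain ⟨w, hw, hw0, hd⟩ := hγ.exists_hasDerivAt_time hf hpos
  have hg : Continuous fun x => w (f x) := hw.comp_continuous hf.continuous hpos
  have ht := tendsto_atTop_of_hasDerivAt_comp hg (fun x => hw0 _ (hpos x)) hd
  have ht' := tendsto_atBot_of_hasDerivAt_comp hg (fun x => hw0 _ (hpos x)) hd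
  have htc : Continuous fun r => (γ r).1 := continuous_iff_continuousAt.2 fun s =>
    (hd s).continuousAt
  have hhc : Continuous (hubbleAlong f γ) :=
    ((hf.continuous_deriv (by simp)).comp htc).div (hf.continuous.comp htc)
      fun s => (hpos _).ne'
  obtain ⟨l, hl⟩ := tendsto_integral_hubbleAlong_atBot hf ha hfa hbot hw hw0 hd ht'
  refine ⟨strictMono_of_deriv_pos fun s => ?_, ht, hhc, ?_⟩
  · rw [(hd s).deriv]
    exact hw0 _ (hpos _)
  · exact tendsto_average hhc (htop.comp ht) hl

end Averages

section Comoving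

variable {E : Type*} [NormedAddCommGroup E] [NormedSpace ℝ E]
  {S : Type*} [TopologicalSpace S] [ChartedSpace E S] [IsManifold 𝓘(ℝ, E) ∞ S]
  {gS : Bundle.ContMDiffRiemannianMetric 𝓘(ℝ, E) ∞ E (fun x : S => TangentSpace 𝓘(ℝ, E) x)}

theorem isPregeodesicOn_const (p : S) (lam : ℝ → ℝ) (J : Set ℝ) :
    IsPregeodesicOn gS (fun _ => p) lam J := by
  refine ⟨contMDiffOn_const, fun c s _ _ w => ?_⟩
  simp [coordChristoffel]

theorem speedSq_const (p : S) (s : ℝ) : speedSq gS (fun _ => p) s = 0 := by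
  have h : velocity 𝓘(ℝ, E) (fun _ : ℝ => p) s = 0 := by
    unfold velocity
    rw [mfderiv_const]
    rfl
  unfold speedSq
  rw [h, map_zero]

theorem isFutureCausalGeodesic_comoving [FiniteDimensional ℝ E] {f : ℝ → ℝ}
    (hf : ContDiff ℝ ∞ f) (hpos : ∀ x, 0 < f x) (p : S) :
    IsFutureCausalGeodesic f (riemannianField gS) (comoving p) := by
  have hd : deriv (fun r : ℝ => r) = fun _ => 1 := funext fun r => (hasDerivAt_id r).deriv
  refine ⟨(isGeodesicOn_gfrw_iff hf hpos isOpen_univ).2 ⟨contDiffOn_id, ?_, fun s _ => ?_⟩,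
    fun s => ⟨?_, ?_⟩⟩
  · exact isPregeodesicOn_const p _ _
  · change deriv (deriv fun r : ℝ => r) s = -(_ * _ * speedSq gS (fun _ => p) s)
    rw [hd, speedSq_const]
    simp
  · rw [gfrwMetric_velocity (γ := comoving p) differentiableAt_id mdifferentiableAt_const]
    change _ * speedSq gS (fun _ => p) s - deriv (fun r : ℝ => r) s ^ 2 ≤ 0
    rw [speedSq_const, hd]
    norm_num
  · change 0 < deriv (fun r : ℝ => r) s
    rw [hd]
    exact one_pos

end Comoving

section MonsterScale

theorem IsMonsterScale.le {f : ℝ → ℝ} {H t₀ a c : ℝ} (hf : IsMonsterScale f H t₀ a c) (x : ℝ) :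
    a ≤ f x := hf.isGLB.1 (mem_range_self x)

theorem IsMonsterScale.deriv_div {f : ℝ → ℝ} {H t₀ a c : ℝ} (hf : IsMonsterScale f H t₀ a c)
    {x : ℝ} (hx : t₀ < x) : deriv f x / f x = H := by
  have h1 : f =ᶠ[𝓝 x] fun y => Real.exp (H * y) := by
    filter_upwards [lt_mem_nhds hx] with y hy
    exact hf.deSitter y hy
  have h2 : HasDerivAt (fun y => Real.exp (H * y)) (Real.exp (H * x) * H) x := by
    simpa using ((hasDerivAt_id x).const_mul H).exp
  rw [h1.deriv_eq, h2.deriv, hf.deSitter x hx]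
  field_simp

/-- The logarithm of a scale function of the cohort whose value at `t₀ - 2` is `R`. -/
noncomputable def monsterExponent (H t₀ R t : ℝ) : ℝ :=
  R * (Real.smoothTransition (t - t₀ + 3) * (1 - Real.smoothTransition (t - t₀ + 1))) +
    H * t * Real.smoothTransition (t - t₀ + 1)

theorem contDiff_monsterExponent (H t₀ R : ℝ) : ContDiff ℝ ∞ (monsterExponent H t₀ R) := by
  have h : ∀ b : ℝ, ContDiff ℝ ∞ fun t : ℝ => Real.smoothTransition (t - t₀ + b) := fun b =>
    Real.smoothTransition.contDiff.comp ((contDiff_id.sub contDiff_const).add contDiff_const)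
  exact (contDiff_const.mul ((h 3).mul (contDiff_const.sub (h 1)))).add
    ((contDiff_const.mul contDiff_id).mul (h 1))

theorem monsterExponent_of_le (H t₀ R : ℝ) {t : ℝ} (ht : t ≤ t₀ - 3) :
    monsterExponent H t₀ R t = 0 := by
  unfold monsterExponent
  rw [Real.smoothTransition.zero_of_nonpos (by linarith),
    Real.smoothTransition.zero_of_nonpos (by linarith)]
  ring

theorem monsterExponent_sub_two (H t₀ R : ℝ) : monsterExponent H t₀ R (t₀ - 2) = R := by
  unfold monsterExponent
  rw [Real.smoothTransition.one_of_one_le (by linarith),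
    Real.smoothTransition.zero_of_nonpos (by linarith)]
  ring

theorem monsterExponent_of_ge (H t₀ R : ℝ) {t : ℝ} (ht : t₀ ≤ t) :
    monsterExponent H t₀ R t = H * t := by
  unfold monsterExponent
  rw [Real.smoothTransition.one_of_one_le (by linarith : 1 ≤ t - t₀ + 1)]
  ring

theorem le_monsterExponent {H : ℝ} (hH : 0 < H) (t₀ R t : ℝ) :
    -|R| - H * (|t₀| + 1) ≤ monsterExponent H t₀ R t := by
  unfold monsterExponent
  have h1 := Real.smoothTransition.nonneg (t - t₀ + 3)
  have h2 := Real.smoothTransition.le_one (t - t₀ + 3)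
  have h3 := Real.smoothTransition.nonneg (t - t₀ + 1)
  have h4 := Real.smoothTransition.le_one (t - t₀ + 1)
  have h0 : t ≤ t₀ - 1 → Real.smoothTransition (t - t₀ + 1) = 0 := fun h =>
    Real.smoothTransition.zero_of_nonpos (by linarith)
  generalize Real.smoothTransition (t - t₀ + 3) = x at *
  generalize Real.smoothTransition (t - t₀ + 1) = y at *
  have h5 : |R * (x * (1 - y))| ≤ |R| * 1 := by
    rw [abs_mul]
    refine mul_le_mul_of_nonneg_left ?_ (abs_nonneg R)
    rw [abs_of_nonneg (mul_nonneg h1 (by linarith))]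
    exact mul_le_one₀ h2 (by linarith) (by linarith)
  have h6 : -(|t₀| + 1) ≤ t * y := by
    rcases le_or_gt t (t₀ - 1) with h | h
    · rw [h0 h, mul_zero]
      linarith [abs_nonneg t₀]
    · have := neg_abs_le t₀
      nlinarith [mul_nonneg h3 (by linarith : 0 ≤ t + |t₀| + 1), abs_nonneg t₀]
  nlinarith [(abs_le.1 h5).1, mul_le_mul_of_nonneg_left h6 hH.le]

theorem exists_isMonsterScale {H : ℝ} (hH : 0 < H) (t₀ R : ℝ) :
    ∃ a, IsMonsterScale (fun t => Real.exp (monsterExponent H t₀ R t)) H t₀ a 1 := by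
  set f : ℝ → ℝ := fun t => Real.exp (monsterExponent H t₀ R t) with hf
  have hlow : Real.exp (-|R| - H * (|t₀| + 1)) ∈ lowerBounds (range f) := by
    rintro _ ⟨t, rfl⟩
    exact Real.exp_le_exp.2 (le_monsterExponent hH t₀ R t)
  have hglb : IsGLB (range f) (sInf (range f)) := isGLB_csInf (range_nonempty f) ⟨_, hlow⟩
  have hlim : Tendsto f atBot (𝓝 1) := by
    refine tendsto_const_nhds.congr' ?_
    filter_upwards [eventually_le_atBot (t₀ - 3)] with t ht
    simp [hf, monsterExponent_of_le H t₀ R ht]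
  exact ⟨sInf (range f), (contDiff_monsterExponent H t₀ R).exp, hH,
    (Real.exp_pos _).trans_le (hglb.2 hlow), hglb,
    ge_of_tendsto' hlim fun t => hglb.1 (mem_range_self t), hlim,
    fun t ht => by simp only [hf, monsterExponent_of_ge H t₀ R ht.le]⟩

theorem hubbleAvg_comoving_exp {S : Type*} {ψ : ℝ → ℝ} (hψ : ContDiff ℝ ∞ ψ) (p : S) (a b : ℝ) :
    hubbleAvg (fun t => Real.exp (ψ t)) (comoving p) a b = 1 / (b - a) * (ψ b - ψ a) := by
  have h1 : ∀ s, HasDerivAt ψ (deriv ψ s) s := fun s => (hψ.differentiable (by simp) s).hasDerivAt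
  have h2 : ∀ s, hubbleAlong (fun t => Real.exp (ψ t)) (comoving p) s = deriv ψ s := by
    intro s
    simp only [hubbleAlong, comoving]
    rw [(h1 s).exp.deriv]
    field_simp
  unfold hubbleAvg
  simp only [h2]
  rw [intervalIntegral.integral_eq_sub_of_hasDerivAt (fun s _ => h1 s)
    ((hψ.continuous_deriv (by simp)).intervalIntegrable _ _)]

theorem injective_exp_monsterExponent (H t₀ : ℝ) :
    Function.Injective fun R t => Real.exp (monsterExponent H t₀ R t) := by
  intro R R' h
  have := congrFun h (t₀ - 2)
  simpa only [monsterExponent_sub_two, Real.exp_eq_exp] using this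

theorem not_countable_isMonsterScale {H : ℝ} (hH : 0 < H) (t₀ : ℝ) :
    ¬ {f : ℝ → ℝ | ∃ a c : ℝ, IsMonsterScale f H t₀ a c}.Countable := by
  intro h
  refine Cardinal.not_countable_real ?_
  refine (h.preimage (injective_exp_monsterExponent H t₀)).mono fun R _ => ?_
  obtain ⟨a, ha⟩ := exists_isMonsterScale hH t₀ R
  exact ⟨a, 1, ha⟩

variable {E : Type*} [NormedAddCommGroup E] [NormedSpace ℝ E]
  {S : Type*} [TopologicalSpace S] [ChartedSpace E S] [IsManifold 𝓘(ℝ, E) ∞ S]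
  (gS : Bundle.ContMDiffRiemannianMetric 𝓘(ℝ, E) ∞ E (fun x : S => TangentSpace 𝓘(ℝ, E) x))

theorem gfrwMetric_injOn [Nonempty S] [Nontrivial E] :
    InjOn (fun f : ℝ → ℝ => gfrwMetric f (riemannianField gS)) {f | ∀ t, 0 < f t} := by
  intro f hf f' hf' h
  obtain ⟨p⟩ := ‹Nonempty S›
  obtain ⟨e, he⟩ := exists_ne (0 : E)
  funext t
  have h1 := gfrwMetric_riemannianField_apply gS f (t, p) (0, e) (0, e)
  have h2 := gfrwMetric_riemannianField_apply gS f' (t, p) (0, e) (0, e)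
  simp only at h
  rw [← h, h1] at h2
  simp only [mul_zero, sub_zero] at h2
  have h3 : 0 < (gS.inner p : E →L[ℝ] E →L[ℝ] ℝ) e e := gS.pos p e he
  exact (pow_left_inj₀ (hf t).le (hf' t).le two_ne_zero).1 (mul_right_cancel₀ h3.ne' h2)

theorem not_countable_monster_metrics [Nonempty S] [Nontrivial E] {H : ℝ} (hH : 0 < H) (t₀ : ℝ) :
    ¬ {g : BilinField (gfrwModel E) (ℝ × S) | ∃ f : ℝ → ℝ, ∃ a c : ℝ,
      IsMonsterScale f H t₀ a c ∧ g = gfrwMetric f (riemannianField gS)}.Countable := by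
  intro h
  refine not_countable_isMonsterScale hH t₀ (MapsTo.countable_of_injOn ?_
    ((gfrwMetric_injOn gS).mono ?_) h)
  · rintro f ⟨a, c, hf⟩
    exact ⟨f, a, c, hf, rfl⟩
  · rintro f ⟨a, c, hf⟩ t
    exact hf.inf_pos.trans_le (hf.le t)

end MonsterScale

section Cohort

variable {E : Type*} [NormedAddCommGroup E] [NormedSpace ℝ E] [FiniteDimensional ℝ E]
  {S : Type*} [TopologicalSpace S] [ChartedSpace E S] [IsManifold 𝓘(ℝ, E) ∞ S]
  {gS : Bundle.ContMDiffRiemannianMetric 𝓘(ℝ, E) ∞ E (fun x : S => TangentSpace 𝓘(ℝ, E) x)}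

theorem IsMonsterScale.averages {f : ℝ → ℝ} {H t₀ a c : ℝ} (hf : IsMonsterScale f H t₀ a c)
    {γ : ℝ → ℝ × S} (hγ : IsFutureCausalGeodesic f (riemannianField gS) γ) :
    (∀ r s : ℝ, r < s → t₀ ≤ (γ r).1 → hubbleAvg f γ r s = H) ∧
      (∃ r, t₀ ≤ (γ r).1) ∧
      (∀ r : ℝ, ∀ᶠ s in atTop, 0 < hubbleAvg f γ r s) ∧
      HasAsymptoticHubbleAverages f γ H := by
  obtain ⟨hmono, htop, _, hasym⟩ := hγ.time_and_averages hf.smooth hf.inf_pos hf.le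
    hf.tendsto_past (tendsto_const_nhds.congr' (by
      filter_upwards [eventually_gt_atTop t₀] with x hx
      exact (hf.deriv_div hx).symm))
  refine ⟨fun r s hrs hr => ?_, (htop.eventually (eventually_ge_atTop t₀)).exists,
    fun r => (hasym.1 r).eventually (lt_mem_nhds hf.hubble_pos), hasym⟩
  have h1 : ∫ x in r..s, hubbleAlong f γ x = ∫ _ in r..s, H := by
    refine intervalIntegral.integral_congr_ae (Eventually.of_forall fun x hx => ?_)
    rw [uIoc_of_le hrs.le] at hx
    exact hf.deriv_div (hr.trans_lt (hmono hx.1))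
  have h2 : s - r ≠ 0 := (sub_pos.2 hrs).ne'
  rw [hubbleAvg, h1, intervalIntegral.integral_const, smul_eq_mul]
  field_simp

theorem contDiff_exp_add (H c : ℝ) : ContDiff ℝ ∞ fun t : ℝ => Real.exp (H * t) + c :=
  (contDiff_const.mul contDiff_id).exp.add contDiff_const

theorem deriv_exp_add (H c t : ℝ) :
    deriv (fun t : ℝ => Real.exp (H * t) + c) t = H * Real.exp (H * t) := by
  have h : HasDerivAt (fun t : ℝ => Real.exp (H * t) + c) (Real.exp (H * t) * (H * 1)) t :=
    ((hasDerivAt_id t).const_mul H).exp.add_const c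
  rw [h.deriv]
  ring

theorem tendsto_hubble_exp_add {H c : ℝ} (hH : 0 < H) (hc : 0 < c) :
    Tendsto (fun t => deriv (fun t : ℝ => Real.exp (H * t) + c) t / (Real.exp (H * t) + c)) atTop
      (𝓝 H) := by
  have h1 : Tendsto (fun t => Real.exp (H * t) + c) atTop atTop :=
    tendsto_atTop_add_const_right _ _ (Real.tendsto_exp_atTop.comp (tendsto_id.const_mul_atTop hH))
  have h2 := (h1.inv_tendsto_atTop.const_mul (H * c)).const_sub H
  rw [mul_zero, sub_zero] at h2
  refine h2.congr fun t => ?_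
  have : Real.exp (H * t) + c ≠ 0 := (add_pos (Real.exp_pos _) hc).ne'
  rw [deriv_exp_add]
  simp only [Pi.inv_apply]
  field_simp
  ring

theorem strictMono_exp_div_add {H c : ℝ} (hH : 0 < H) (hc : 0 < c) :
    StrictMono fun t : ℝ => H * (Real.exp (H * t) / (Real.exp (H * t) + c)) := by
  intro x y hxy
  have h := Real.exp_lt_exp.2 (mul_lt_mul_of_pos_left hxy hH)
  have hx := Real.exp_pos (H * x)
  have hy := Real.exp_pos (H * y)
  refine mul_lt_mul_of_pos_left ?_ hH
  rw [div_lt_div_iff₀ (by positivity) (by positivity)]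
  nlinarith

theorem averages_exp_add {H c : ℝ} (hH : 0 < H) (hc : 0 < c) {γ : ℝ → ℝ × S}
    (hγ : IsFutureCausalGeodesic (fun t => Real.exp (H * t) + c) (riemannianField gS) γ) :
    (∀ r s : ℝ, r < s →
      0 < hubbleAvg (fun t => Real.exp (H * t) + c) γ r s ∧
      hubbleAvg (fun t => Real.exp (H * t) + c) γ r s
        < H * (Real.exp (H * (γ s).1) / (Real.exp (H * (γ s).1) + c))) ∧
    HasAsymptoticHubbleAverages (fun t => Real.exp (H * t) + c) γ H := by
  have hbot : Tendsto (fun t => Real.exp (H * t) + c) atBot (𝓝 c) := by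
    simpa using (Real.tendsto_exp_atBot.comp (tendsto_id.const_mul_atBot hH)).add_const c
  obtain ⟨hmono, _, hcont, hasym⟩ := hγ.time_and_averages (contDiff_exp_add H c) hc
    (fun x => by linarith [Real.exp_pos (H * x)]) hbot (tendsto_hubble_exp_add hH hc)
  refine ⟨fun r s hrs => ?_, hasym⟩
  have hval : ∀ x, hubbleAlong (fun t => Real.exp (H * t) + c) γ x =
      H * (Real.exp (H * (γ x).1) / (Real.exp (H * (γ x).1) + c)) := fun x => by
    rw [hubbleAlong, deriv_exp_add, mul_div_assoc]
  have hsr : 0 < s - r := sub_pos.2 hrs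
  constructor
  · refine mul_pos (by positivity)
      (intervalIntegral.intervalIntegral_pos_of_pos (hcont.intervalIntegrable r s) (fun x => ?_) hrs)
    rw [hval]
    positivity
  · have h1 := intervalIntegral.integral_lt_integral_of_continuousOn_of_le_of_exists_lt hrs
      hcont.continuousOn (continuousOn_const
        (c := H * (Real.exp (H * (γ s).1) / (Real.exp (H * (γ s).1) + c)))) (fun x hx => by
        rw [hval]
        exact (strictMono_exp_div_add hH hc).monotone (hmono.monotone hx.2))
      ⟨r, left_mem_Icc.2 hrs.le, by
        rw [hval]
        exact strictMono_exp_div_add hH hc (hmono hrs)⟩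
    rw [intervalIntegral.integral_const, smul_eq_mul] at h1
    rw [hubbleAvg, one_div, inv_mul_lt_iff₀ hsr]
    exact h1

end Cohort

theorem mainTheorem1 {E : Type*} [NormedAddCommGroup E] [NormedSpace ℝ E] [FiniteDimensional ℝ E]
    {S : Type*} [TopologicalSpace S] [T2Space S] [SecondCountableTopology S]
    [ChartedSpace E S] [IsManifold 𝓘(ℝ, E) ∞ S]
    (gS : Bundle.ContMDiffRiemannianMetric 𝓘(ℝ, E) ∞ E (fun x : S => TangentSpace 𝓘(ℝ, E) x))
    (hS : GeodesicallyComplete 𝓘(ℝ, E) (riemannianField gS)) :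
    -- every spacetime of the cohort is complete although its Hubble averages become positive
    (∀ f : ℝ → ℝ, ∀ H t₀ a c : ℝ, IsMonsterScale f H t₀ a c →
      IsCompleteGFRW f (riemannianField gS) ∧
      (∀ p : S, IsFutureCausalGeodesic f (riemannianField gS) (comoving p)) ∧
      ∀ γ : ℝ → ℝ × S, IsFutureCausalGeodesic f (riemannianField gS) γ →
        (∀ r s : ℝ, r < s → t₀ ≤ (γ r).1 → hubbleAvg f γ r s = H) ∧
        (∃ r, t₀ ≤ (γ r).1) ∧
        (∀ r : ℝ, ∀ᶠ s in atTop, 0 < hubbleAvg f γ r s) ∧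
        HasAsymptoticHubbleAverages f γ H) ∧
    -- the average over a compact comoving segment can be any real number
    (∀ H t₀ r : ℝ, 0 < H → ∃ f : ℝ → ℝ, ∃ a c : ℝ, IsMonsterScale f H t₀ a c ∧
      ∃ s₁ s₂ : ℝ, s₁ < s₂ ∧ ∀ p : S, hubbleAvg f (comoving p) s₁ s₂ = r) ∧
    -- there are uncountably many scale functions in the cohort, and uncountably many metrics
    (∀ H t₀ : ℝ, 0 < H →
      ¬ {f : ℝ → ℝ | ∃ a c : ℝ, IsMonsterScale f H t₀ a c}.Countable ∧
      (Nonempty S → Nontrivial E →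
        ¬ {g : BilinField (gfrwModel E) (ℝ × S) | ∃ f : ℝ → ℝ, ∃ a c : ℝ,
            IsMonsterScale f H t₀ a c ∧ g = gfrwMetric f (riemannianField gS)}.Countable)) ∧
    -- the example `exp (H t) + c`
    (∀ H c : ℝ, 0 < H → 0 < c →
      IsCompleteGFRW (fun t => Real.exp (H * t) + c) (riemannianField gS) ∧
      ∀ γ : ℝ → ℝ × S, IsFutureCausalGeodesic (fun t => Real.exp (H * t) + c) (riemannianField gS) γ →
        (∀ r s : ℝ, r < s →
          0 < hubbleAvg (fun t => Real.exp (H * t) + c) γ r s ∧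
          hubbleAvg (fun t => Real.exp (H * t) + c) γ r s
            < H * (Real.exp (H * (γ s).1) / (Real.exp (H * (γ s).1) + c))) ∧
        HasAsymptoticHubbleAverages (fun t => Real.exp (H * t) + c) γ H) := by
  refine ⟨fun f H t₀ a c hf => ⟨isCompleteGFRW hf.smooth hf.inf_pos hf.le hS, fun p =>
      isFutureCausalGeodesic_comoving hf.smooth (fun x => hf.inf_pos.trans_le (hf.le x)) p,
      fun γ hγ => hf.averages hγ⟩, fun H t₀ r hH => ?_,
    fun H t₀ hH => ⟨not_countable_isMonsterScale hH t₀,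
      fun _ _ => not_countable_monster_metrics gS hH t₀⟩,
    fun H c hH hc => ⟨isCompleteGFRW (contDiff_exp_add H c) hc
      (fun x => by linarith [Real.exp_pos (H * x)]) hS, fun γ hγ => averages_exp_add hH hc hγ⟩⟩
  obtain ⟨a, ha⟩ := exists_isMonsterScale hH t₀ r
  refine ⟨_, a, 1, ha, t₀ - 3, t₀ - 2, by linarith, fun p => ?_⟩
  rw [hubbleAvg_comoving_exp (contDiff_monsterExponent H t₀ r), monsterExponent_sub_two,
    monsterExponent_of_le H t₀ r le_rfl]
  norm_num
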